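/- Let $N$ be a connected complex Lie group with identity element $e_N$ and Lie algebra $\mathfrak n$. Let $S$ be a connected reductive complex linear algebraic group acting holomorphically on $N$ by group automorphisms, via $\eta : S \to \mathrm{Aut}(N)$, and let $K(S) \subset S$ be a maximal compact subgroup. Put $G := N \rtimes K(S)$, which acts on $N$ by $\tau(u,a)(v) = u\,\eta(a)(v)$. Let $H$ be a connected reductive complex linear algebraic group, $K \subset H$ a maximal compact subgroup, and $\mathfrak k = \mathrm{Lie}(K)$. An *equivariant hermitian principal $H$-bundle* $(E_H, E_K; \rho)$ on $N$ is a $C^\infty$ principal $H$-bundle $E_H \to N$ with a $C^\infty$ reduction of structure group $E_K \subset E_H$ to $K$, and a $C^\infty$ left action $\rho$ of $G$ on $E_H$ that lifts the action $\tau$ on $N$, commutes with the action of $H$, and satisfies $\rho(G \times E_K) = E_K$. Consider the quadruples $((E_H, E_K; \rho), \nabla)$, where $\nabla$ is a connection on the principal $K$-bundle $E_K$ that is preserved by the action of $G$ on $E_K$. An isomorphism of two quadruples is a $C^\infty$ isomorphism $E_H \to E'_H$ of principal $H$-bundles over $\mathrm{Id}_N$ that is $G$-equivariant, takes $E_K$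 onto $E'_K$, and takes $\nabla$ to $\nabla'$. Let $\mathcal C$ be the set of equivalence classes of pairs $(\beta, \omega)$, where $\beta : K(S) \to K$ is a homomorphism of Lie groups and $\omega : \mathfrak n \to \mathfrak k$ is an $\mathbb R$-linear map fixed by $K(S)$, which acts on $\mathfrak n$ through $\eta$ and on $\mathfrak k$ through $\mathrm{Ad}\circ\beta$. Two pairs $(\beta,\omega)$, $(\beta',\omega')$ are equivalent if there is $k \in K$ with $\beta'(a) = k\beta(a)k^{-1}$ for all $a \in K(S)$ and $\omega'(v) = \mathrm{Ad}(k)(\omega(v))$ for all $v \in \mathfrak n$. **Proposition.** There is a bijection $\Phi$ from $\mathcal C$ to the set of isomorphism classes of quadruples $((E_H, E_K; \rho), \nabla)$, with the following two properties. 1. Let $(\beta,\omega)$ be a pair as above. Then $\Phi$ takes the class of $(\beta,\omega)$ to the class of the following quadruple (which exists and is unique up to isomorphism). The bundle $E_K$ is $G \times^{K(S)} K$, the quotient of $G \times K$ by the relation $(g,k) \sim (ga, \beta(a)^{-1}k)$, $a \in K(S)$; the bundle $E_H$ is its extension to $H$; the group $G$ acts by left translation; and $\nabla = \nabla' + \widetilde\omega$.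 Here $\nabla'$ is the connection on $E_K$ induced by the flat connection on the principal $K(S)$-bundle $G \to N$ whose horizontal leaves are the cosets $gN$, and $\widetilde\omega$ is the unique $G$-invariant $C^\infty$ section of $\mathrm{ad}(E_K) \otimes T^*N$ with $\widetilde\omega(e_N) = \omega$, where $\mathrm{ad}(E_K)_{e_N}$ is identified with $\mathfrak k$ using the class of the identity element of $G \times K$. The convention for the sum is that the horizontal lift of a tangent vector $w$ for $\nabla' + \widetilde\omega$ is its horizontal lift for $\nabla'$ plus the vertical vector $\widetilde\omega(w)$. 2. Let $((E_H, E_K; \rho), \nabla)$ be a quadruple. The fibre $(E_K)_{e_N}$ is non-empty, and for every $z_0 \in (E_K)_{e_N}$ there is exactly one pair $(\beta, \omega)$ as above such that $\rho(a, z_0) = z_0\beta(a)$ for all $a \in K(S)$ and $\omega = d' - \delta$; moreover, $\Phi^{-1}$ takes the class of the quadruple to the class of this pair. Here $d' : \mathfrak n \to T_{z_0}E_K$ is the inverse of the restriction of the differential of $E_K \to N$ to the horizontal subspace of $\nabla$ at $z_0$, $\delta : \mathfrak n \to T_{z_0}E_K$ is given by the action of $N \subset G$ on $E_K$, and the vertical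 tangent space at $z_0$ is identified with $\mathfrak k$ by the action of $K$. -/

import Mathlib

open scoped Manifold ContDiff

universe u

noncomputable section

/-! ### Tangent spaces and Lie algebras -/

section Tangent

/-- Transport of tangent vectors along an equality of base points. -/
def castTangent {E : Type*} [NormedAddCommGroup E] [NormedSpace ℝ E] {M₀ : Type*}
    [TopologicalSpace M₀] (I : ModelWithCorners ℝ E M₀) {M : Type*} [TopologicalSpace M]
    [ChartedSpace M₀ M] {x y : M} (h : x = y) : TangentSpace I x →L[ℝ] TangentSpace I y :=
  h ▸ ContinuousLinearMap.id ℝ (TangentSpace I x)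

theorem mk_castTangent {E : Type*} [NormedAddCommGroup E] [NormedSpace ℝ E] {M₀ : Type*}
    [TopologicalSpace M₀] (I : ModelWithCorners ℝ E M₀) {M : Type*} [TopologicalSpace M]
    [ChartedSpace M₀ M] {x y : M} (h : x = y) (v : TangentSpace I x) :
    (⟨y, castTangent I h v⟩ : TangentBundle I M) = ⟨x, v⟩ := by
  subst h; rfl

variable (EA : Type*) [NormedAddCommGroup EA] [NormedSpace ℝ EA]
  {A : Type*} [TopologicalSpace A] [ChartedSpace EA A] [Group A]
  (EB : Type*) [NormedAddCommGroup EB] [NormedSpace ℝ EB]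
  {B : Type*} [TopologicalSpace B] [ChartedSpace EB B] [Group B]

/-- The linear map `Lie(A) → Lie(B)` induced by a homomorphism `f : A → B` of real Lie groups:
the differential of `f` at the identity element. -/
def lieMap (f : A →* B) : GroupLieAlgebra 𝓘(ℝ, EA) A →L[ℝ] GroupLieAlgebra 𝓘(ℝ, EB) B :=
  (castTangent 𝓘(ℝ, EB) f.map_one).comp (mfderiv 𝓘(ℝ, EA) 𝓘(ℝ, EB) f 1)

theorem tangentMap_one_eq (f : A →* B) (X : GroupLieAlgebra 𝓘(ℝ, EA) A) :
    tangentMap 𝓘(ℝ, EA) 𝓘(ℝ, EB) f ⟨1, X⟩ = ⟨1, lieMap EA EB f X⟩ :=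
  (mk_castTangent 𝓘(ℝ, EB) f.map_one _).symm

/-- The adjoint action `Ad(a)` on `Lie(A)`: the differential of `x ↦ a x a⁻¹`. -/
def lieAd (a : A) : GroupLieAlgebra 𝓘(ℝ, EA) A →L[ℝ] GroupLieAlgebra 𝓘(ℝ, EA) A :=
  lieMap EA EA (MulAut.conj a).toMonoidHom

end Tangent

/-! ### Reductive complex linear algebraic groups -/

section Reductive

variable (E : Type*) [NormedAddCommGroup E] [NormedSpace ℂ E]
  {H : Type*} [TopologicalSpace H] [ChartedSpace E H] [Group H]

/-- A subset of `GL(n, ℂ)` is Zariski closed if it is the locus in `GL(n, ℂ)` where some set of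
polynomials in the matrix entries vanishes. -/
def IsZariskiClosedGL {n : ℕ} (X : Set (GL (Fin n) ℂ)) : Prop :=
  ∃ P : Set (MvPolynomial (Fin n × Fin n) ℂ),
    X = {g : GL (Fin n) ℂ | ∀ p ∈ P, MvPolynomial.eval (fun ij => (g : Matrix (Fin n) (Fin n) ℂ) ij.1 ij.2) p = 0}

/-- The homomorphism `r` identifies the complex Lie group `H` with a complex linear algebraic
group, that is, with a Zariski closed subgroup of `GL(n, ℂ)`. -/
structure IsLinearAlgebraicVia {n : ℕ} (r : H →* GL (Fin n) ℂ) : Prop where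
  isEmbedding : Topology.IsEmbedding r
  holomorphic : ∀ i j, ContMDiff 𝓘(ℂ, E) 𝓘(ℂ) ω
    (fun h : H => (r h : Matrix (Fin n) (Fin n) ℂ) i j)
  zariskiClosed : IsZariskiClosedGL (Set.range r)

/-- `H` is a reductive complex linear algebraic group: it is a linear algebraic group whose
unipotent radical is trivial, that is, the only connected algebraic normal subgroup
consisting of unipotent elements is the trivial one. -/
def IsReductiveLinearAlgebraic (H : Type*) [TopologicalSpace H] [ChartedSpace E H] [Group H] :
    Prop :=
  ∃ (n : ℕ) (r : H →* GL (Fin n) ℂ), IsLinearAlgebraicVia E r ∧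
    ∀ U : Subgroup H, U.Normal → IsZariskiClosedGL (r '' (U : Set H)) →
      IsConnected (U : Set H) →
      (∀ x ∈ U, IsNilpotent ((r x : Matrix (Fin n) (Fin n) ℂ) - 1)) → U = ⊥

/-- `K` is a maximal compact subgroup of `H`. -/
def IsMaximalCompactSubgroup {H : Type*} [TopologicalSpace H] [Group H] (K : Subgroup H) : Prop :=
  Maximal (fun L : Subgroup H => IsCompact (L : Set H)) K

end Reductive

/-! ### Smooth principal bundles and connections -/

section Principal

variable (EB : Type*) [NormedAddCommGroup EB] [NormedSpace ℝ EB]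
  (B : Type u) [TopologicalSpace B] [ChartedSpace EB B]
  (EG : Type*) [NormedAddCommGroup EG] [NormedSpace ℝ EG]
  (G : Type u) [TopologicalSpace G] [ChartedSpace EG G] [Group G]

/-- A `C^∞` principal bundle over the manifold `B` with structure group the Lie group `G`: a smooth
manifold (the total space) with a smooth projection to `B` and a smooth right action of `G`, which
is locally over `B` equivariantly diffeomorphic to the product of `B` and `G`. -/
structure PrincipalBundle where
  /-- the total space -/
  carrier : Type u
  [topologicalSpace : TopologicalSpace carrier]
  [chartedSpace : ChartedSpace (ModelProd EB EG) carrier]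
  [isManifold : IsManifold (𝓘(ℝ, EB).prod 𝓘(ℝ, EG)) ∞ carrier]
  /-- the projection to the base -/
  proj : carrier → B
  /-- the right action of the structure group -/
  rsmul : carrier → G → carrier
  contMDiff_proj : ContMDiff (𝓘(ℝ, EB).prod 𝓘(ℝ, EG)) 𝓘(ℝ, EB) ∞ proj
  contMDiff_rsmul : ContMDiff ((𝓘(ℝ, EB).prod 𝓘(ℝ, EG)).prod 𝓘(ℝ, EG))
    (𝓘(ℝ, EB).prod 𝓘(ℝ, EG)) ∞ (fun p : carrier × G => rsmul p.1 p.2)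
  rsmul_one : ∀ z, rsmul z 1 = z
  rsmul_mul : ∀ z g h, rsmul z (g * h) = rsmul (rsmul z g) h
  proj_rsmul : ∀ z g, proj (rsmul z g) = proj z
  locally_trivial : ∀ b : B, ∃ U : Set B, IsOpen U ∧ b ∈ U ∧
    ∃ e : OpenPartialHomeomorph carrier (B × G),
      e.source = proj ⁻¹' U ∧ e.target = U ×ˢ Set.univ ∧
      ContMDiffOn (𝓘(ℝ, EB).prod 𝓘(ℝ, EG)) (𝓘(ℝ, EB).prod 𝓘(ℝ, EG)) ∞ e e.source ∧
      ContMDiffOn (𝓘(ℝ, EB).prod 𝓘(ℝ, EG)) (𝓘(ℝ, EB).prod 𝓘(ℝ, EG)) ∞ e.symm e.target ∧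
      (∀ z ∈ e.source, (e z).1 = proj z) ∧
      ∀ z ∈ e.source, ∀ g, (e (rsmul z g)).2 = (e z).2 * g

attribute [instance] PrincipalBundle.topologicalSpace PrincipalBundle.chartedSpace
  PrincipalBundle.isManifold

variable {EB B EG G}

/-- The model with corners of the total space of a principal bundle. -/
abbrev PrincipalBundle.model (_ : PrincipalBundle EB B EG G) :
    ModelWithCorners ℝ (EB × EG) (ModelProd EB EG) :=
  𝓘(ℝ, EB).prod 𝓘(ℝ, EG)

variable (P : PrincipalBundle EB B EG G)

/-- The differential of the projection. -/
def PrincipalBundle.dproj (z : P.carrier) :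
    TangentSpace P.model z →L[ℝ] TangentSpace 𝓘(ℝ, EB) (P.proj z) :=
  mfderiv P.model 𝓘(ℝ, EB) P.proj z

/-- The identification of `Lie(G)` with the vertical tangent space at `z`: the differential at
the identity element of the orbit map `g ↦ z g`. -/
def PrincipalBundle.vert (z : P.carrier) :
    GroupLieAlgebra 𝓘(ℝ, EG) G →L[ℝ] TangentSpace P.model z :=
  (castTangent P.model (P.rsmul_one z)).comp
    (mfderiv 𝓘(ℝ, EG) P.model (fun g : G => P.rsmul z g) 1)

/-- A smooth 1-form on the total space of `P` with values in `Lie(G)` that is equivariant: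
`R_g^* θ = Ad(g⁻¹) ∘ θ`. Smoothness is smoothness as a function on the tangent bundle. -/
structure EquivariantForm where
  /-- the 1-form -/
  form : ∀ z : P.carrier, TangentSpace P.model z →L[ℝ] GroupLieAlgebra 𝓘(ℝ, EG) G
  smooth : ContMDiff (M' := EG) P.model.tangent 𝓘(ℝ, EG) ∞
    (fun X : TangentBundle P.model P.carrier => form X.proj X.snd)
  equivariant : ∀ (z : P.carrier) (g : G) (X : TangentSpace P.model z),
    form (P.rsmul z g) (mfderiv P.model P.model (fun w => P.rsmul w g) z X) =
      lieAd EG g⁻¹ (form z X)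

/-- A connection on the principal bundle `P`, given by its connection 1-form. -/
structure PrincipalConnection extends EquivariantForm P where
  form_vert : ∀ (z : P.carrier) (a : GroupLieAlgebra 𝓘(ℝ, EG) G), form z (P.vert z a) = a

/-- The horizontal subspace of a connection at a point of the total space. -/
def PrincipalConnection.horizontal {P : PrincipalBundle EB B EG G} (c : PrincipalConnection P)
    (z : P.carrier) : Submodule ℝ (TangentSpace P.model z) :=
  LinearMap.ker (c.form z : TangentSpace P.model z →ₗ[ℝ] GroupLieAlgebra 𝓘(ℝ, EG) G)

/-- A smooth section of `ad(P) ⊗ T^*B`, that is, a 1-form on `B` with values in the adjoint bundle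
`ad(P) = P ×^G Lie(G)`, written as an equivariant `Lie(G)`-valued 1-form on `P` that vanishes on
vertical vectors. The element of `ad(P)` assigned to a tangent vector `dproj z X` of `B` is the
class of `(z, form z X)`. -/
structure AdjointForm extends EquivariantForm P where
  form_vert : ∀ (z : P.carrier) (a : GroupLieAlgebra 𝓘(ℝ, EG) G), form z (P.vert z a) = 0

variable {P}

/-- `c = c' + α` in the affine space of connections over the space of sections of
`ad(P) ⊗ T^*B`. A connection is regarded as a splitting `TB → TP/G` of the Atiyah sequence
`0 → ad(P) → TP/G → TB → 0`, so that the horizontal lifts for `c' + α` are the horizontal lifts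
for `c'` plus the vertical vectors given by `α`. -/
def PrincipalConnection.IsSum (c c' : PrincipalConnection P) (α : AdjointForm P) : Prop :=
  ∀ (z : P.carrier), ∀ X ∈ c'.horizontal z, X + P.vert z (α.form z X) ∈ c.horizontal z

end Principal

/-! ### Equivariant hermitian principal bundles with invariant connection

Here `A` acts on `N` through `φ`, and `N ⋊[φ] A` is the semidirect product, with underlying
manifold `N × A`. -/

section Equivariant

variable (EN : Type*) [NormedAddCommGroup EN] [NormedSpace ℝ EN]
  {N : Type u} [TopologicalSpace N] [ChartedSpace EN N] [Group N]
  (EA : Type*) [NormedAddCommGroup EA] [NormedSpace ℝ EA]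
  {A : Type*} [TopologicalSpace A] [ChartedSpace EA A] [Group A]
  (EH : Type*) [NormedAddCommGroup EH] [NormedSpace ℝ EH]
  {H : Type u} [TopologicalSpace H] [ChartedSpace EH H] [Group H]
  (φ : A →* MulAut N)
  (K : Subgroup H) (EK : Type*) [NormedAddCommGroup EK] [NormedSpace ℝ EK] [ChartedSpace EK K]

/-- The action of `N ⋊ A` on `N`, given by `(u, a)(v) = u φ(a)(v)`. -/
def semidirectAct {N A : Type*} [Group N] [Group A] {φ : A →* MulAut N} (g : N ⋊[φ] A) (v : N) :
    N :=
  g.left * φ g.right v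

/-- An equivariant hermitian principal `H`-bundle `(E_H, E_K; ρ)` on `N`. The reduction `E_K ⊂ E_H`
of the structure group to `K` is a principal `K`-bundle with a `K`-equivariant embedding into `E_H`
over the identity map of `N`. -/
structure EquivariantHermitianBundle where
  /-- the principal `H`-bundle `E_H` -/
  bundleH : PrincipalBundle EN N EH H
  /-- the principal `K`-bundle `E_K` -/
  bundleK : PrincipalBundle EN N EK K
  /-- the inclusion of `E_K` in `E_H` -/
  incl : bundleK.carrier → bundleH.carrier
  isSmoothEmbedding_incl :
    Manifold.IsSmoothEmbedding bundleK.model bundleH.model ∞ incl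
  proj_incl : ∀ z, bundleH.proj (incl z) = bundleK.proj z
  incl_rsmul : ∀ z (k : K), incl (bundleK.rsmul z k) = bundleH.rsmul (incl z) (k : H)
  /-- the left action `ρ` -/
  act : N ⋊[φ] A → bundleH.carrier → bundleH.carrier
  act_one : ∀ z, act 1 z = z
  act_mul : ∀ g g' z, act (g * g') z = act g (act g' z)
  contMDiff_act : ContMDiff ((𝓘(ℝ, EN).prod 𝓘(ℝ, EA)).prod bundleH.model) bundleH.model ∞
    (fun p : (N × A) × bundleH.carrier => act ⟨p.1.1, p.1.2⟩ p.2)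
  proj_act : ∀ g z, bundleH.proj (act g z) = semidirectAct g (bundleH.proj z)
  act_rsmul : ∀ g z h, act g (bundleH.rsmul z h) = bundleH.rsmul (act g z) h
  act_incl : (fun p : (N ⋊[φ] A) × bundleH.carrier => act p.1 p.2) ''
    (Set.univ ×ˢ Set.range incl) = Set.range incl

variable {EN EA EH φ K EK}

theorem EquivariantHermitianBundle.exists_actK
    (E : EquivariantHermitianBundle EN EA EH φ K EK) (g : N ⋊[φ] A) (z : E.bundleK.carrier) :
    ∃ w, E.incl w = E.act g (E.incl z) := by
  have h : E.act g (E.incl z) ∈ Set.range E.incl := by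
    rw [← E.act_incl]
    exact ⟨(g, E.incl z), ⟨Set.mem_univ _, z, rfl⟩, rfl⟩
  exact h

/-- The restriction to `E_K` of the action of `N ⋊ A` on `E_H`. -/
def EquivariantHermitianBundle.actK (E : EquivariantHermitianBundle EN EA EH φ K EK)
    (g : N ⋊[φ] A) (z : E.bundleK.carrier) : E.bundleK.carrier :=
  (E.exists_actK g z).choose

theorem EquivariantHermitianBundle.incl_actK (E : EquivariantHermitianBundle EN EA EH φ K EK)
    (g : N ⋊[φ] A) (z : E.bundleK.carrier) : E.incl (E.actK g z) = E.act g (E.incl z) :=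
  (E.exists_actK g z).choose_spec

theorem EquivariantHermitianBundle.actK_one (E : EquivariantHermitianBundle EN EA EH φ K EK)
    (z : E.bundleK.carrier) : E.actK 1 z = z :=
  E.isSmoothEmbedding_incl.isEmbedding.injective (by rw [E.incl_actK, E.act_one])

/-- A 1-form on `E_K` (for example a connection form) is invariant if it is preserved by the
action of `N ⋊ A` on `E_K`. -/
def EquivariantForm.IsInvariant {E : EquivariantHermitianBundle EN EA EH φ K EK}
    (θ : EquivariantForm E.bundleK) : Prop :=
  ∀ (g : N ⋊[φ] A) (z : E.bundleK.carrier) (X : TangentSpace E.bundleK.model z),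
    θ.form (E.actK g z) (mfderiv E.bundleK.model E.bundleK.model (E.actK g) z X) = θ.form z X

variable (EN EA EH φ K EK) in
/-- An equivariant hermitian principal `H`-bundle `(E_H, E_K; ρ)` together with an invariant
connection on `E_K`. -/
structure HermitianQuadruple extends EquivariantHermitianBundle EN EA EH φ K EK where
  /-- the connection on `E_K` -/
  conn : PrincipalConnection bundleK
  invariant : EquivariantForm.IsInvariant (E := toEquivariantHermitianBundle)
    conn.toEquivariantForm

/-- An isomorphism of quadruples: an isomorphism `E_H → E'_H` of principal `H`-bundles over the
identity of `N` which commutes with the actions of `N ⋊ A`, takes `E_K` onto `E'_K`, and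
takes the connection on `E_K` to that on `E'_K`. The field `toK` is the induced map
`E_K → E'_K`. -/
structure HermitianQuadruple.Iso (Q Q' : HermitianQuadruple EN EA EH φ K EK) where
  /-- the isomorphism `E_H → E'_H` -/
  toH : Diffeomorph Q.bundleH.model Q'.bundleH.model Q.bundleH.carrier Q'.bundleH.carrier ∞
  /-- the restriction `E_K → E'_K` -/
  toK : Diffeomorph Q.bundleK.model Q'.bundleK.model Q.bundleK.carrier Q'.bundleK.carrier ∞
  incl_toK : ∀ z, Q'.incl (toK z) = toH (Q.incl z)
  proj_toH : ∀ z, Q'.bundleH.proj (toH z) = Q.bundleH.proj z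
  toH_rsmul : ∀ z h, toH (Q.bundleH.rsmul z h) = Q'.bundleH.rsmul (toH z) h
  toH_act : ∀ g z, toH (Q.act g z) = Q'.act g (toH z)
  conn_toK : ∀ (z : Q.bundleK.carrier) (X : TangentSpace Q.bundleK.model z),
    Q'.conn.form (toK z) (mfderiv Q.bundleK.model Q'.bundleK.model toK z X) = Q.conn.form z X

/-- Two quadruples are isomorphic. -/
def HermitianQuadruple.IsIsomorphic (Q Q' : HermitianQuadruple EN EA EH φ K EK) : Prop :=
  Nonempty (Q.Iso Q')

theorem HermitianQuadruple.IsIsomorphic.refl (Q : HermitianQuadruple EN EA EH φ K EK) :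
    Q.IsIsomorphic Q :=
  ⟨{ toH := Diffeomorph.refl _ _ _
     toK := Diffeomorph.refl _ _ _
     incl_toK := fun _ => rfl
     proj_toH := fun _ => rfl
     toH_rsmul := fun _ _ => rfl
     toH_act := fun _ _ => rfl
     conn_toK := fun z X => by
      have h : mfderiv Q.bundleK.model Q.bundleK.model
          (Diffeomorph.refl Q.bundleK.model Q.bundleK.carrier ∞) z =
          ContinuousLinearMap.id ℝ (TangentSpace Q.bundleK.model z) := mfderiv_id
      rw [h]; rfl }⟩

theorem HermitianQuadruple.IsIsomorphic.symm {Q Q' : HermitianQuadruple EN EA EH φ K EK}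
    (h : Q.IsIsomorphic Q') : Q'.IsIsomorphic Q := by
  obtain ⟨f⟩ := h
  refine ⟨{ toH := f.toH.symm, toK := f.toK.symm, incl_toK := ?_, proj_toH := ?_,
            toH_rsmul := ?_, toH_act := ?_, conn_toK := ?_ }⟩
  · intro z
    apply f.toH.injective
    have := f.incl_toK (f.toK.symm z)
    simp only [Diffeomorph.apply_symm_apply] at this
    exact this.symm.trans (f.toH.apply_symm_apply _).symm
  · intro z
    rw [← f.proj_toH]; simp
  · intro z h
    apply f.toH.injective
    refine (f.toH.apply_symm_apply _).trans ((f.toH_rsmul _ _).trans ?_).symm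
    simp
  · intro g z
    apply f.toH.injective
    refine (f.toH.apply_symm_apply _).trans ((f.toH_act _ _).trans ?_).symm
    simp
  · intro z X
    have hd : MDifferentiable Q.bundleK.model Q'.bundleK.model f.toK :=
      f.toK.mdifferentiable (by simp)
    have hd' : MDifferentiable Q'.bundleK.model Q.bundleK.model f.toK.symm :=
      f.toK.symm.mdifferentiable (by simp)
    rw [← f.conn_toK]
    have hc : tangentMap Q'.bundleK.model Q'.bundleK.model (f.toK ∘ f.toK.symm) ⟨z, X⟩ =
        tangentMap Q.bundleK.model Q'.bundleK.model f.toK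
          (tangentMap Q'.bundleK.model Q.bundleK.model f.toK.symm ⟨z, X⟩) :=
      congrFun (tangentMap_comp hd hd') _
    have hid : (f.toK ∘ f.toK.symm : Q'.bundleK.carrier → Q'.bundleK.carrier) = id := by
      ext w; simp
    rw [hid, tangentMap_id] at hc
    exact congrArg (fun T : TangentBundle Q'.bundleK.model Q'.bundleK.carrier =>
      Q'.conn.form T.proj T.snd) hc.symm

theorem HermitianQuadruple.IsIsomorphic.trans {Q Q' Q'' : HermitianQuadruple EN EA EH φ K EK}
    (h : Q.IsIsomorphic Q') (h' : Q'.IsIsomorphic Q'') : Q.IsIsomorphic Q'' := by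
  obtain ⟨f⟩ := h
  obtain ⟨f'⟩ := h'
  refine ⟨{ toH := f.toH.trans f'.toH, toK := f.toK.trans f'.toK, incl_toK := ?_, proj_toH := ?_,
            toH_rsmul := ?_, toH_act := ?_, conn_toK := ?_ }⟩
  · intro z
    exact (f'.incl_toK _).trans (congrArg f'.toH (f.incl_toK z))
  · intro z
    exact (f'.proj_toH _).trans (f.proj_toH z)
  · intro z h
    exact (congrArg f'.toH (f.toH_rsmul z h)).trans (f'.toH_rsmul _ _)
  · intro g z
    exact (congrArg f'.toH (f.toH_act g z)).trans (f'.toH_act _ _)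
  · intro z X
    have hd : MDifferentiableAt Q.bundleK.model Q'.bundleK.model f.toK z :=
      f.toK.mdifferentiable (by simp) z
    have hd' : MDifferentiableAt Q'.bundleK.model Q''.bundleK.model f'.toK (f.toK z) :=
      f'.toK.mdifferentiable (by simp) _
    have hc : mfderiv Q.bundleK.model Q''.bundleK.model (f.toK.trans f'.toK) z =
        (mfderiv Q'.bundleK.model Q''.bundleK.model f'.toK (f.toK z)).comp
          (mfderiv Q.bundleK.model Q'.bundleK.model f.toK z) := mfderiv_comp z hd' hd
    rw [hc]
    exact (f'.conn_toK _ _).trans (f.conn_toK z X)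

variable (EN EA EH φ K EK) in
/-- Isomorphism of quadruples as an equivalence relation. -/
instance HermitianQuadruple.setoid : Setoid (HermitianQuadruple EN EA EH φ K EK) where
  r := HermitianQuadruple.IsIsomorphic
  iseqv := ⟨.refl, .symm, .trans⟩

variable (EN EA EH φ K EK) in
/-- The set of isomorphism classes of quadruples `((E_H, E_K; ρ), ∇)`. -/
def HermitianQuadrupleClasses : Type _ :=
  Quotient (HermitianQuadruple.setoid EN EA EH φ K EK)

/-- The isomorphism class of a quadruple. -/
def HermitianQuadruple.cls (Q : HermitianQuadruple EN EA EH φ K EK) :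
    HermitianQuadrupleClasses EN EA EH φ K EK :=
  Quotient.mk _ Q

end Equivariant

/-! ### The set of pairs `(β, ω)` -/

section Pairs

variable (EN : Type*) [NormedAddCommGroup EN] [NormedSpace ℝ EN]
  {N : Type u} [TopologicalSpace N] [ChartedSpace EN N] [Group N]
  (EA : Type*) [NormedAddCommGroup EA] [NormedSpace ℝ EA]
  {A : Type*} [TopologicalSpace A] [ChartedSpace EA A] [Group A]
  (φ : A →* MulAut N)
  (EB : Type*) [NormedAddCommGroup EB] [NormedSpace ℝ EB]
  (B : Type*) [TopologicalSpace B] [ChartedSpace EB B] [Group B]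

/-- A pair `(β, ω)` of a homomorphism of Lie groups `β : A → B` and an `ℝ`-linear map
`ω : Lie(N) → Lie(B)` that is invariant under the action of `A` (which acts on `Lie(N)` through
`φ` and on `Lie(B)` through `Ad ∘ β`). -/
structure InvariantPair where
  /-- the homomorphism -/
  β : A →* B
  contMDiff_β : ContMDiff 𝓘(ℝ, EA) 𝓘(ℝ, EB) ∞ β
  /-- the linear map -/
  omega : GroupLieAlgebra 𝓘(ℝ, EN) N →ₗ[ℝ] GroupLieAlgebra 𝓘(ℝ, EB) B
  invariant : ∀ (a : A) (v : GroupLieAlgebra 𝓘(ℝ, EN) N),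
    lieAd EB (β a) (omega (lieMap EN EN (φ a⁻¹).toMonoidHom v)) = omega v

variable {EN EA φ EB B}

/-- Equivalence of pairs: simultaneous conjugation by an element of `B`. -/
def InvariantPair.IsEquivalent (p p' : InvariantPair EN EA φ EB B) : Prop :=
  ∃ k : B, (∀ a, p'.β a = k * p.β a * k⁻¹) ∧ ∀ v, p'.omega v = lieAd EB k (p.omega v)

theorem lieAd_one (X : GroupLieAlgebra 𝓘(ℝ, EB) B) : lieAd EB 1 X = X := by
  have h : (⇑(MulAut.conj (1 : B)).toMonoidHom : B → B) = id := by
    ext x; simp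
  have hc := tangentMap_one_eq EB EB (MulAut.conj (1 : B)).toMonoidHom X
  rw [h, tangentMap_id] at hc
  simpa [lieAd] using hc.symm

theorem lieAd_mul [LieGroup 𝓘(ℝ, EB) ∞ B] (a b : B) (X : GroupLieAlgebra 𝓘(ℝ, EB) B) :
    lieAd EB (a * b) X = lieAd EB a (lieAd EB b X) := by
  have hs : ∀ c : B, MDifferentiable 𝓘(ℝ, EB) 𝓘(ℝ, EB) (MulAut.conj c).toMonoidHom := by
    intro c
    have : ContMDiff 𝓘(ℝ, EB) 𝓘(ℝ, EB) ∞ (fun x : B => c * x * c⁻¹) :=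
      (contMDiff_const.mul contMDiff_id).mul contMDiff_const
    exact this.mdifferentiable (by simp)
  have h : (⇑(MulAut.conj (a * b)).toMonoidHom : B → B) =
      (MulAut.conj a).toMonoidHom ∘ (MulAut.conj b).toMonoidHom := by
    ext x; simp
  have hc := congrFun (tangentMap_comp (hs a) (hs b)) (⟨1, X⟩ : TangentBundle 𝓘(ℝ, EB) B)
  rw [← h, Function.comp_apply, tangentMap_one_eq, tangentMap_one_eq, tangentMap_one_eq] at hc
  simpa [lieAd] using hc

variable (EN EA φ EB B) in
/-- Equivalence of pairs as an equivalence relation. -/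
instance InvariantPair.setoid [LieGroup 𝓘(ℝ, EB) ∞ B] : Setoid (InvariantPair EN EA φ EB B) where
  r := InvariantPair.IsEquivalent
  iseqv :=
    { refl := fun p => ⟨1, by simp, fun v => (lieAd_one _).symm⟩
      symm := by
        rintro p p' ⟨k, h1, h2⟩
        refine ⟨k⁻¹, fun a => by rw [h1]; group, fun v => ?_⟩
        rw [h2, ← lieAd_mul, inv_mul_cancel, lieAd_one]
      trans := by
        rintro p p' p'' ⟨k, h1, h2⟩ ⟨l, h3, h4⟩
        refine ⟨l * k, fun a => by rw [h3, h1]; group, fun v => ?_⟩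
        rw [h4, h2, ← lieAd_mul] }

variable (EN EA φ EB B) in
/-- The set `𝒞` of equivalence classes of pairs `(β, ω)`. -/
def InvariantPairClasses [LieGroup 𝓘(ℝ, EB) ∞ B] : Type _ :=
  Quotient (InvariantPair.setoid EN EA φ EB B)

/-- The equivalence class of a pair. -/
def InvariantPair.cls [LieGroup 𝓘(ℝ, EB) ∞ B] (p : InvariantPair EN EA φ EB B) :
    InvariantPairClasses EN EA φ EB B :=
  Quotient.mk _ p

end Pairs

/-! ### The correspondence between pairs and quadruples -/

section Correspondence

variable {EN : Type*} [NormedAddCommGroup EN] [NormedSpace ℝ EN]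
  {N : Type u} [TopologicalSpace N] [ChartedSpace EN N] [Group N]
  {EA : Type*} [NormedAddCommGroup EA] [NormedSpace ℝ EA]
  {A : Type*} [TopologicalSpace A] [ChartedSpace EA A] [Group A]
  {EH : Type*} [NormedAddCommGroup EH] [NormedSpace ℝ EH]
  {H : Type u} [TopologicalSpace H] [ChartedSpace EH H] [Group H]
  {φ : A →* MulAut N}
  {K : Subgroup H} {EK : Type*} [NormedAddCommGroup EK] [NormedSpace ℝ EK] [ChartedSpace EK K]

/-- The map `q : G × K → E_K`, where `G = N ⋊ A`, exhibits `E_K` as the associated principal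
`K`-bundle `G ×^A K` of the principal `A`-bundle `G → N` and the homomorphism `β : A → K`, with the
action of `G` given by left translation: `q` is a surjective submersion, its fibres are the classes
of the relation `(g, k) ∼ (g a, β(a)⁻¹ k)`, and it is compatible with the projections and actions.
So `E_K` is the quotient manifold of `G × K` by this relation. -/
structure IsAssociatedBundle (E : EquivariantHermitianBundle EN EA EH φ K EK) (β : A →* K)
    (q : N ⋊[φ] A → K → E.bundleK.carrier) : Prop where
  contMDiff : ContMDiff ((𝓘(ℝ, EN).prod 𝓘(ℝ, EA)).prod 𝓘(ℝ, EK)) E.bundleK.model ∞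
    (fun x : (N × A) × K => q ⟨x.1.1, x.1.2⟩ x.2)
  submersion : ∀ x : (N × A) × K,
    Function.Surjective (mfderiv ((𝓘(ℝ, EN).prod 𝓘(ℝ, EA)).prod 𝓘(ℝ, EK)) E.bundleK.model
      (fun x : (N × A) × K => q ⟨x.1.1, x.1.2⟩ x.2) x)
  surjective : ∀ z, ∃ g k, q g k = z
  eq_iff : ∀ g₁ k₁ g₂ k₂, q g₁ k₁ = q g₂ k₂ ↔
    ∃ a : A, g₂ = g₁ * SemidirectProduct.inr a ∧ k₂ = (β a)⁻¹ * k₁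
  proj_eq : ∀ g k, E.bundleK.proj (q g k) = g.left
  rsmul_eq : ∀ g k k', E.bundleK.rsmul (q g k) k' = q g (k * k')
  actK_eq : ∀ g' g k, E.actK g' (q g k) = q (g' * g) k

theorem IsAssociatedBundle.proj_one {E : EquivariantHermitianBundle EN EA EH φ K EK} {β : A →* K}
    {q : N ⋊[φ] A → K → E.bundleK.carrier} (h : IsAssociatedBundle E β q) :
    E.bundleK.proj (q 1 1) = 1 :=
  h.proj_eq 1 1

/-- The connection `c` on `E_K = G ×^A K` is the one induced by the tautological flat connection on
the principal `A`-bundle `G → N`, whose horizontal subspace at `g` is the tangent space of the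
leaf `g N`. -/
def IsInducedFlatConnection {E : EquivariantHermitianBundle EN EA EH φ K EK}
    (q : N ⋊[φ] A → K → E.bundleK.carrier) (c : PrincipalConnection E.bundleK) : Prop :=
  ∀ (g : N ⋊[φ] A) (k : K) (v : GroupLieAlgebra 𝓘(ℝ, EN) N),
    mfderiv 𝓘(ℝ, EN) E.bundleK.model
        (fun n : N => q (g * SemidirectProduct.inl n) k) 1 v ∈
      c.horizontal (q (g * SemidirectProduct.inl 1) k)

/-- The quadruple `Q` is constructed from the pair `(β, ω)`: its bundle `E_K` is
`G ×^A K` with `G = N ⋊ A` acting by left translation, and its connection is `∇' + α`, where `∇'` is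
induced by the tautological flat connection on `G → N`, and `α` is the `G`-invariant section of
`ad(E_K) ⊗ T^*N` whose value at the identity element of `N` is `ω`, the fibre of `ad(E_K)` there
being identified with `Lie(K)` by means of the class `q 1 1` of the identity element of `G × K`.
The bundle `E_H`, of which `E_K` is a reduction, is then the extension of `E_K` to `H`, with the
induced action. -/
def HermitianQuadruple.IsConstructedFrom (Q : HermitianQuadruple EN EA EH φ K EK)
    (p : InvariantPair EN EA φ EK K) : Prop :=
  ∃ (q : N ⋊[φ] A → K → Q.bundleK.carrier)
    (hq : IsAssociatedBundle Q.toEquivariantHermitianBundle p.β q)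
    (c' : PrincipalConnection Q.bundleK) (α : AdjointForm Q.bundleK),
    IsInducedFlatConnection (E := Q.toEquivariantHermitianBundle) q c' ∧
    EquivariantForm.IsInvariant (E := Q.toEquivariantHermitianBundle) α.toEquivariantForm ∧
    (∀ X : TangentSpace Q.bundleK.model (q 1 1),
      α.form (q 1 1) X =
        p.omega (castTangent 𝓘(ℝ, EN) hq.proj_one (Q.bundleK.dproj (q 1 1) X))) ∧
    Q.conn.IsSum c' α

/-- The map `δ : Lie(N) → T_z E_K` given by the action of `N` on `E_K`: the differential at the
identity element of the orbit map of `z`. -/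
def EquivariantHermitianBundle.delta (E : EquivariantHermitianBundle EN EA EH φ K EK)
    (z : E.bundleK.carrier) :
    GroupLieAlgebra 𝓘(ℝ, EN) N →L[ℝ] TangentSpace E.bundleK.model z :=
  (castTangent E.bundleK.model (by rw [map_one, E.actK_one] :
      E.actK (SemidirectProduct.inl 1) z = z)).comp
    (mfderiv 𝓘(ℝ, EN) E.bundleK.model (fun n : N => E.actK (SemidirectProduct.inl n) z) 1)

/-- The pair `(β, ω)` is read off from the quadruple `Q` at a point `z` of `E_K` over the identity
element of `N`: the isotropy action is `ρ(a, z) = z β(a)`, and `ω = d' - δ`, where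
`d'` is the inverse of the restriction of the differential of the projection to the horizontal
subspace at `z`, and vertical vectors at `z` are identified with elements of `Lie(K)`. The second
condition is stated for the horizontal vectors `X = d'(v)`. -/
def HermitianQuadruple.ReadsOff (Q : HermitianQuadruple EN EA EH φ K EK)
    (z : Q.bundleK.carrier) (hz : Q.bundleK.proj z = 1)
    (p : InvariantPair EN EA φ EK K) : Prop :=
  (∀ a : A, Q.actK (SemidirectProduct.inr a) z = Q.bundleK.rsmul z (p.β a)) ∧
  ∀ X ∈ Q.conn.horizontal z, ∀ v : GroupLieAlgebra 𝓘(ℝ, EN) N,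
    castTangent 𝓘(ℝ, EN) hz (Q.bundleK.dproj z X) = v →
      X - Q.delta z v = Q.bundleK.vert z (p.omega v)

end Correspondence

end

/-! Everything is `C^∞`, so the complex groups are used through their underlying real Lie groups;
write `A` for `K(S)` and `φ` for its action on `N`. The subgroup `N` of `G` acts on the base by left
translations, hence simply transitively. So once a point `z` of `E_K` over the identity is chosen,
the orbit map `n ↦ n z` is a global section, and `(n, k) ↦ n z k` trivializes `E_K`; the same
formula trivializes `E_H`.

In this trivialization little freedom is left. Elements of `A` fix the identity of `N`, so `a z = z
β(a)`, and `(u, a)` acts by `(n, k) ↦ (u φ(a)(n), β(a) k)`. An invariant connection form `θ` is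
determined by its values at `z`; on vertical vectors it is prescribed, and on the orbit of `N` it is
`-ω`, where `ω = d' - δ` (`readsOff_iff`). Hence `θ` is the Maurer–Cartan form of `K` minus `Ad(k⁻¹)
∘ ω` applied to that of `N`. Conversely, these formulas define a quadruple `ofPair` for every pair,
and its connection is invariant because `ω` is fixed by `A`.

The bijection rests on three facts: a pair can be read off at every point over the identity
(`exists_readsOff`); a quadruple off which `p` is read is isomorphic to `ofPair p`
(`ReadsOff.isIsomorphic_ofPair`); and a quadruple constructed from `p` yields `p` at the class of
the identity (`IsConstructedFrom.exists_readsOff`). Replacing `z` by `z k⁻¹` conjugates the pair by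
`k`, and isomorphisms of quadruples preserve pairs, so equivalence classes correspond to isomorphism
classes. -/

noncomputable section

/-! ### Complex Lie groups as real Lie groups -/

section RestrictScalars

variable {E : Type*} [NormedAddCommGroup E] [NormedSpace ℂ E]
  {M : Type*} [TopologicalSpace M] [ChartedSpace E M]
  {F : Type*} [NormedAddCommGroup F] [NormedSpace ℂ F]
  {M' : Type*} [TopologicalSpace M'] [ChartedSpace F M']
  {E' : Type*} [NormedAddCommGroup E'] [NormedSpace ℂ E']
  {M'' : Type*} [TopologicalSpace M''] [ChartedSpace E' M'']

theorem IsManifold.restrictScalars_real [IsManifold 𝓘(ℂ, E) ω M] : IsManifold 𝓘(ℝ, E) ∞ M := by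
  refine isManifold_of_contDiffOn _ _ _ fun e e' he he' => ?_
  have h := (contDiffGroupoid ω 𝓘(ℂ, E)).compatible he he'
  exact ((contDiffGroupoid_le (n := ω) (m := ∞) le_top h).1.restrict_scalars ℝ)

theorem ContMDiff.restrictScalars_real {f : M → M'} (hf : ContMDiff 𝓘(ℂ, E) 𝓘(ℂ, F) ω f) :
    ContMDiff 𝓘(ℝ, E) 𝓘(ℝ, F) ∞ f := by
  intro x
  have h := contMDiffAt_iff.1 (hf x)
  refine contMDiffAt_iff.2 ⟨h.1, ?_⟩
  exact (h.2.of_le le_top).restrict_scalars ℝ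

/-- Needed separately because the model on a product is a product of models, not the model `𝓘` of
the product space. -/
theorem ContMDiff.restrictScalars_real_prod {f : M × M'' → M'}
    (hf : ContMDiff (𝓘(ℂ, E).prod 𝓘(ℂ, E')) 𝓘(ℂ, F) ω f) :
    ContMDiff (𝓘(ℝ, E).prod 𝓘(ℝ, E')) 𝓘(ℝ, F) ∞ f := by
  intro x
  have h := contMDiffAt_iff.1 (hf x)
  refine contMDiffAt_iff.2 ⟨h.1, ?_⟩
  exact (h.2.of_le le_top).restrict_scalars ℝ

theorem LieGroup.restrictScalars_real [Group M] [LieGroup 𝓘(ℂ, E) ω M] :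
    LieGroup 𝓘(ℝ, E) ∞ M where
  toIsManifold := .restrictScalars_real
  contMDiff_mul := (contMDiff_mul 𝓘(ℂ, E) ω).restrictScalars_real_prod
  contMDiff_inv := (_root_.contMDiff_inv 𝓘(ℂ, E) ω).restrictScalars_real

end RestrictScalars

/-! ### Smoothness of maps into tangent spaces and of partial differentials -/

section TangentCalculus

variable {E : Type*} [NormedAddCommGroup E] [NormedSpace ℝ E] {X : Type*} [TopologicalSpace X]
  {I : ModelWithCorners ℝ E X} {M : Type*} [TopologicalSpace M] [ChartedSpace X M]
  {E' : Type*} [NormedAddCommGroup E'] [NormedSpace ℝ E'] {X' : Type*} [TopologicalSpace X']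
  {I' : ModelWithCorners ℝ E' X'} {M' : Type*} [TopologicalSpace M'] [ChartedSpace X' M']
  {E'' : Type*} [NormedAddCommGroup E''] [NormedSpace ℝ E''] {X'' : Type*} [TopologicalSpace X'']
  {I'' : ModelWithCorners ℝ E'' X''} {M'' : Type*} [TopologicalSpace M''] [ChartedSpace X'' M'']

theorem trivializationAt_tangent_self [IsManifold I 1 M] (x : M) (v : TangentSpace I x) :
    (trivializationAt E (TangentSpace I) x ⟨x, v⟩).2 = v := by
  rw [TangentBundle.trivializationAt_eq_localTriv]
  exact (tangentBundleCore I M).coordChange_self (achart _ x) x (mem_chart_source X x) v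

/-- A map into a fixed tangent space is smooth iff it is so as a map into the tangent bundle. -/
theorem contMDiff_tangentSpace_iff [IsManifold I 1 M] {n : ℕ∞ω} {x : M}
    {f : M' → TangentSpace I x} :
    ContMDiff (M' := TangentBundle I M) I' I.tangent n (fun y => ⟨x, f y⟩) ↔
      ContMDiff (M' := E) I' 𝓘(ℝ, E) n f := by
  refine forall_congr' fun y => ?_
  rw [Bundle.contMDiffAt_totalSpace]
  simp only [trivializationAt_tangent_self]
  exact and_iff_right contMDiffAt_const

theorem mfderiv_partial_right [IsManifold I 1 M] [IsManifold I' 1 M'] {f : M × M' → M''} {x : M}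
    {y : M'} (hf : MDifferentiableAt (I.prod I') I'' f (x, y)) (v : TangentSpace I' y) :
    mfderiv I' I'' (fun z => f (x, z)) y v = mfderiv (I.prod I') I'' f (x, y) ((0 : E), (v : E')) := by
  have h := mfderiv_comp (f := fun z : M' => (x, z)) (g := f) y hf
    (mdifferentiableAt_const.prodMk mdifferentiableAt_id)
  refine (congrArg (fun L => L v) h).trans ?_
  rw [mfderiv_prod_right]
  rfl

/-- The partial tangent map of a smooth map of two variables is smooth. -/
theorem ContMDiff.tangentMap_partial [IsManifold I ∞ M] [IsManifold I' ∞ M']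
    [IsManifold I'' ∞ M''] {f : M × M' → M''} (hf : ContMDiff (I.prod I') I'' ∞ f) :
    ContMDiff (I.prod I'.tangent) I''.tangent ∞
      (fun p : M × TangentBundle I' M' => tangentMap I' I'' (fun z => f (p.1, z)) p.2) := by
  -- The partial differential is the full differential applied to `(0, Y)`, and the zero section is
  -- smooth.
  have h1 : ContMDiff (I.prod I'.tangent) (I.tangent.prod I'.tangent) ∞
      (fun p : M × TangentBundle I' M' => ((⟨p.1, 0⟩ : TangentBundle I M), p.2)) :=
    ((Bundle.contMDiff_zeroSection ℝ (TangentSpace I : M → Type _)).comp contMDiff_fst).prodMk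
      contMDiff_snd
  have h2 : ContMDiff _ _ ∞ (equivTangentBundleProd I M I' M').symm :=
    contMDiff_equivTangentBundleProd_symm
  have h3 := hf.contMDiff_tangentMap (m := ∞) le_rfl
  refine ((h3.comp h2).comp h1).congr fun p => ?_
  exact congrArg (Bundle.TotalSpace.mk (f (p.1, p.2.proj)))
    (mfderiv_partial_right (hf.mdifferentiable (by simp) _) _)

end TangentCalculus

/-! ### Smoothness of the Maurer–Cartan form and of the adjoint action -/

section LieGroup

variable {E : Type*} [NormedAddCommGroup E] [NormedSpace ℝ E]
  {G : Type*} [TopologicalSpace G] [ChartedSpace E G] [Group G]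

variable (E) in
/-- The Maurer–Cartan form of a Lie group, at `g`: left translation of `T_g G` to the identity. -/
def maurerCartan (g : G) : TangentSpace 𝓘(ℝ, E) g →L[ℝ] GroupLieAlgebra 𝓘(ℝ, E) G :=
  (castTangent 𝓘(ℝ, E) (inv_mul_cancel g)).comp
    (mfderiv 𝓘(ℝ, E) 𝓘(ℝ, E) (fun x => g⁻¹ * x) g)

theorem mk_maurerCartan (g : G) (v : TangentSpace 𝓘(ℝ, E) g) :
    (⟨1, maurerCartan E g v⟩ : TangentBundle 𝓘(ℝ, E) G) =
      tangentMap 𝓘(ℝ, E) 𝓘(ℝ, E) (fun x => g⁻¹ * x) ⟨g, v⟩ :=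
  mk_castTangent _ _ _

variable [LieGroup 𝓘(ℝ, E) ∞ G]

/-- The value at `X` is the partial differential of `(g, x) ↦ g⁻¹ x` in `x`, with `g` set to the
base point of `X`. It lies in the fixed space `T_1 G`, where smoothness may be tested in the tangent
bundle. -/
theorem contMDiff_maurerCartan : ContMDiff (M' := E) 𝓘(ℝ, E).tangent 𝓘(ℝ, E) ∞
    (fun X : TangentBundle 𝓘(ℝ, E) G => maurerCartan E X.proj X.snd) := by
  have hG : IsManifold 𝓘(ℝ, E) 1 G := .of_le (n := ∞) (by simp)
  refine (contMDiff_tangentSpace_iff (x := (1 : G)) (M := G)).1 ?_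
  have h : ContMDiff (𝓘(ℝ, E).prod 𝓘(ℝ, E)) 𝓘(ℝ, E) ∞ (fun p : G × G => p.1⁻¹ * p.2) :=
    contMDiff_fst.inv.mul contMDiff_snd
  refine (h.tangentMap_partial.comp
    ((Bundle.contMDiff_proj (TangentSpace 𝓘(ℝ, E) : G → Type _)).prodMk contMDiff_id)).congr
    fun X => mk_maurerCartan _ _

theorem contMDiff_lieAd : ContMDiff (M := G × E) (M' := E) (𝓘(ℝ, E).prod 𝓘(ℝ, E)) 𝓘(ℝ, E) ∞
    (fun p => lieAd E p.1 (p.2 : GroupLieAlgebra 𝓘(ℝ, E) G)) := by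
  have hG : IsManifold 𝓘(ℝ, E) 1 G := .of_le (n := ∞) (by simp)
  refine (contMDiff_tangentSpace_iff (x := (1 : G)) (M := G)).1 ?_
  have h : ContMDiff (𝓘(ℝ, E).prod 𝓘(ℝ, E)) 𝓘(ℝ, E) ∞ (fun p : G × G => p.1 * p.2 * p.1⁻¹) :=
    (contMDiff_fst.mul contMDiff_snd).mul contMDiff_fst.inv
  have h2 : ContMDiff (M' := TangentBundle 𝓘(ℝ, E) G) 𝓘(ℝ, E) 𝓘(ℝ, E).tangent ∞
      (fun v : E => ⟨1, v⟩) := contMDiff_tangentSpace_iff.2 contMDiff_id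
  exact (h.tangentMap_partial.comp (contMDiff_fst.prodMk (h2.comp contMDiff_snd))).congr
    fun p => (tangentMap_one_eq E E (MulAut.conj p.1).toMonoidHom _).symm

end LieGroup

/-! ### Principal bundles: fibres, vertical vectors, connection forms -/

section Principal

variable {EB : Type*} [NormedAddCommGroup EB] [NormedSpace ℝ EB]
  {B : Type u} [TopologicalSpace B] [ChartedSpace EB B]
  {EG : Type*} [NormedAddCommGroup EG] [NormedSpace ℝ EG]
  {G : Type u} [TopologicalSpace G] [ChartedSpace EG G] [Group G]
  {EM : Type*} [NormedAddCommGroup EM] [NormedSpace ℝ EM] {M₀ : Type*} [TopologicalSpace M₀]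
  {I : ModelWithCorners ℝ EM M₀} {M : Type*} [TopologicalSpace M] [ChartedSpace M₀ M]

namespace PrincipalBundle

variable (P : PrincipalBundle EB B EG G)

theorem nonempty_fibre (b : B) : ∃ z, P.proj z = b := by
  obtain ⟨U, -, hb, e, hs, ht, -, -, hp, -⟩ := P.locally_trivial b
  have hm : (b, (1 : G)) ∈ e.target := by rw [ht]; exact ⟨hb, trivial⟩
  refine ⟨e.symm (b, 1), ?_⟩
  rw [← hp _ (e.map_target hm), e.right_inv hm]

theorem rsmul_injective (z : P.carrier) : Function.Injective (P.rsmul z) := by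
  intro g h hgh
  obtain ⟨U, -, hb, e, hs, -, -, -, -, hr⟩ := P.locally_trivial (P.proj z)
  have hz : z ∈ e.source := by rw [hs]; exact hb
  have := congrArg (fun w => (e w).2) hgh
  simpa [hr z hz] using this

theorem exists_rsmul_eq {z w : P.carrier} (h : P.proj w = P.proj z) : ∃ g, w = P.rsmul z g := by
  obtain ⟨U, -, hb, e, hs, -, -, -, hp, hr⟩ := P.locally_trivial (P.proj z)
  have hz : z ∈ e.source := by rw [hs]; exact hb
  have hw : w ∈ e.source := by rw [hs, Set.mem_preimage, h]; exact hb
  refine ⟨(e z).2⁻¹ * (e w).2, ?_⟩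
  have hzg : P.rsmul z ((e z).2⁻¹ * (e w).2) ∈ e.source := by
    rw [hs, Set.mem_preimage, P.proj_rsmul]; exact hb
  refine e.injOn hw hzg (Prod.ext ?_ ?_)
  · rw [hp _ hw, hp _ hzg, P.proj_rsmul, h]
  · rw [hr z hz, mul_inv_cancel_left]

theorem contMDiff_rsmul_left (z : P.carrier) :
    ContMDiff 𝓘(ℝ, EG) P.model ∞ (fun g => P.rsmul z g) :=
  P.contMDiff_rsmul.comp (contMDiff_const.prodMk contMDiff_id)

theorem contMDiff_rsmul_right (g : G) :
    ContMDiff P.model P.model ∞ (fun z => P.rsmul z g) :=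
  P.contMDiff_rsmul.comp (contMDiff_id.prodMk contMDiff_const)

/-- The translation function of a principal bundle is smooth. -/
theorem contMDiff_of_eq_rsmul [LieGroup 𝓘(ℝ, EG) ∞ G] {s f : M → P.carrier} {g : M → G}
    (hs : ContMDiff I P.model ∞ s) (hf : ContMDiff I P.model ∞ f)
    (h : ∀ m, f m = P.rsmul (s m) (g m)) : ContMDiff I 𝓘(ℝ, EG) ∞ g := by
  intro m
  obtain ⟨U, hU, hb, e, hes, -, he, -, -, hr⟩ := P.locally_trivial (P.proj (s m))
  have hsm : s m ∈ e.source := by rw [hes]; exact hb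
  have hfm : f m ∈ e.source := by rw [hes, Set.mem_preimage, h, P.proj_rsmul]; exact hb
  have h1 : ContMDiffAt I 𝓘(ℝ, EG) ∞ (fun m' => (e (s m')).2) m :=
    ((he.contMDiffAt (e.open_source.mem_nhds hsm)).comp m (hs m)).snd
  have h2 : ContMDiffAt I 𝓘(ℝ, EG) ∞ (fun m' => (e (f m')).2) m :=
    ((he.contMDiffAt (e.open_source.mem_nhds hfm)).comp m (hf m)).snd
  refine (h1.inv.mul h2).congr_of_eventuallyEq ?_
  filter_upwards [hs.continuous.continuousAt.preimage_mem_nhds (e.open_source.mem_nhds hsm)]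
    with m' hm'
  change g m' = (e (s m')).2⁻¹ * (e (f m')).2
  rw [h, hr _ hm', inv_mul_cancel_left]

theorem mk_vert (z : P.carrier) (a : GroupLieAlgebra 𝓘(ℝ, EG) G) :
    (⟨z, P.vert z a⟩ : TangentBundle P.model P.carrier) =
      tangentMap 𝓘(ℝ, EG) P.model (fun g => P.rsmul z g) ⟨1, a⟩ :=
  mk_castTangent _ _ _

theorem dproj_vert (z : P.carrier) (a : GroupLieAlgebra 𝓘(ℝ, EG) G) :
    P.dproj z (P.vert z a) = 0 := by
  have hd := (P.contMDiff_rsmul_left z).mdifferentiable (by simp)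
  have hp := P.contMDiff_proj.mdifferentiable (by simp)
  have h := congrFun (tangentMap_comp hp hd) ⟨1, a⟩
  rw [Function.comp_apply, ← P.mk_vert] at h
  have hc : P.proj ∘ (fun g => P.rsmul z g) = fun _ => P.proj z :=
    funext fun g => P.proj_rsmul z g
  rw [hc] at h
  have h0 : tangentMap 𝓘(ℝ, EG) 𝓘(ℝ, EB) (fun _ : G => P.proj z) ⟨1, a⟩ = ⟨P.proj z, 0⟩ := by
    simp only [tangentMap, mfderiv_const]
    rfl
  rw [h0] at h
  exact (Bundle.TotalSpace.mk_inj.1 h).symm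

/-- Vectors in the kernel of the differential of the projection are vertical. -/
theorem exists_vert_eq [IsManifold 𝓘(ℝ, EB) ∞ B] [LieGroup 𝓘(ℝ, EG) ∞ G] {z : P.carrier}
    {X : TangentSpace P.model z} (hX : P.dproj z X = 0) : ∃ a, P.vert z a = X := by
  have hB : IsManifold 𝓘(ℝ, EB) 1 B := .of_le (n := ∞) (by simp)
  have hG : IsManifold 𝓘(ℝ, EG) 1 G := .of_le (n := ∞) (by simp)
  obtain ⟨U, hU, hb, e, hes, het, he, he', hp, hr⟩ := P.locally_trivial (P.proj z)
  have hz : z ∈ e.source := by rw [hes]; exact hb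
  set g₀ := (e z).2
  -- Translating the trivialization by `g₀` puts `z` at `(P.proj z, 1)`. Then `σ` inverts `τ` near
  -- `z`, and `σ (P.proj z, ·)` is the orbit map of `z`. If `X` projects to zero, then `dτ X = (0,
  -- a)`, so `X = dσ (0, a)` is the vertical vector of `a`.
  let σ : B × G → P.carrier := fun q => P.rsmul (e.symm (q.1, g₀)) q.2
  let τ : P.carrier → B × G := fun w => (P.proj w, g₀⁻¹ * (e w).2)
  have hez : e z = (P.proj z, g₀) := Prod.ext (hp z hz) rfl
  have hτz : τ z = (P.proj z, 1) := by simp [τ, g₀]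
  have hσ : MDifferentiableAt P.model P.model σ (P.proj z, 1) := by
    have h1 : ContMDiffAt P.model P.model ∞ e.symm (P.proj z, g₀) :=
      he'.contMDiffAt (e.open_target.mem_nhds (by rw [← hez]; exact e.map_source hz))
    have h2 : ContMDiffAt P.model P.model ∞ (fun q : B × G => e.symm (q.1, g₀)) (P.proj z, 1) :=
      ContMDiffAt.comp (P.proj z, (1 : G)) (g := e.symm) (f := fun q : B × G => (q.1, g₀)) h1
        (contMDiffAt_fst.prodMk contMDiffAt_const)
    exact ((P.contMDiff_rsmul _).comp _ (h2.prodMk contMDiffAt_snd)).mdifferentiableAt (by simp)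
  have hg : MDifferentiableAt P.model 𝓘(ℝ, EG) (fun w => g₀⁻¹ * (e w).2) z :=
    (contMDiffAt_const.mul
      (he.contMDiffAt (e.open_source.mem_nhds hz)).snd).mdifferentiableAt (by simp)
  have hpr : MDifferentiableAt P.model 𝓘(ℝ, EB) P.proj z :=
    P.contMDiff_proj.mdifferentiable (by simp) z
  have hid : id =ᶠ[nhds z] σ ∘ τ := by
    filter_upwards [e.open_source.mem_nhds hz] with w hw
    have hm : (P.proj w, g₀) ∈ e.target := by
      rw [het]; rw [hes] at hw; exact ⟨hw, trivial⟩
    have hs : e.symm (P.proj w, g₀) ∈ e.source := e.map_target hm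
    have hpw : P.proj (e.symm (P.proj w, g₀)) = P.proj w := by
      rw [← hp _ hs, e.right_inv hm]
    have hs' : (σ ∘ τ) w ∈ e.source := by
      rw [hes, Set.mem_preimage]; simp only [σ, τ, Function.comp_apply, P.proj_rsmul, hpw]
      rw [hes] at hw; exact hw
    refine e.injOn hw hs' (Prod.ext ?_ ?_)
    · rw [hp _ hw, hp _ hs']; simp only [σ, τ, Function.comp_apply, P.proj_rsmul, hpw]
    · simp only [σ, τ, Function.comp_apply]
      rw [hr _ hs, e.right_inv hm, mul_inv_cancel_left]
  have hτ : MDifferentiableAt P.model P.model τ z := hpr.prodMk hg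
  have hσ' : MDifferentiableAt P.model P.model σ (τ z) := by rw [hτz]; exact hσ
  have hXe : (⟨z, X⟩ : TangentBundle P.model P.carrier) =
      tangentMap P.model P.model σ (tangentMap P.model P.model τ ⟨z, X⟩) := by
    rw [← tangentMap_comp_at _ (by exact hσ') hτ]
    have : mfderiv P.model P.model (σ ∘ τ) z = mfderiv P.model P.model id z :=
      hid.symm.mfderiv_eq
    refine Eq.trans (congrFun tangentMap_id.symm _) ?_
    simp only [tangentMap]
    rw [this]
    exact Bundle.TotalSpace.ext hid.self_of_nhds (heq_of_eq rfl)
  have hτX : tangentMap P.model P.model τ ⟨z, X⟩ =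
      ⟨(P.proj z, 1), ((0 : EB), (mfderiv P.model 𝓘(ℝ, EG) (fun w => g₀⁻¹ * (e w).2) z X : EG))⟩ := by
    refine Bundle.TotalSpace.ext hτz (heq_of_eq ?_)
    have h := mfderiv_prodMk hpr hg
    refine (congrArg (fun L => L X) h).trans ?_
    exact Prod.ext hX rfl
  let a : GroupLieAlgebra 𝓘(ℝ, EG) G :=
    (mfderiv P.model 𝓘(ℝ, EG) (fun w => g₀⁻¹ * (e w).2) z X : EG)
  refine ⟨a, ?_⟩
  suffices h : (⟨z, P.vert z a⟩ : TangentBundle P.model P.carrier) = ⟨z, X⟩ from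
    Bundle.TotalSpace.mk_inj.1 h
  rw [hXe, hτX, P.mk_vert]
  have hσz : (fun g : G => σ (P.proj z, g)) = fun g => P.rsmul z g := by
    funext g
    simp only [σ]
    rw [← hez, e.left_inv hz]
  rw [← hσz]
  exact congrArg (Bundle.TotalSpace.mk (σ (P.proj z, 1))) (mfderiv_partial_right hσ a)

end PrincipalBundle

variable {P : PrincipalBundle EB B EG G}

/-- The value of an equivariant form on an element of the tangent bundle. -/
def EquivariantForm.eval (θ : EquivariantForm P) (X : TangentBundle P.model P.carrier) :
    GroupLieAlgebra 𝓘(ℝ, EG) G :=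
  θ.form X.proj X.snd

theorem EquivariantForm.eval_rsmul (θ : EquivariantForm P) (g : G)
    (X : TangentBundle P.model P.carrier) :
    θ.eval (tangentMap P.model P.model (fun w => P.rsmul w g) X) = lieAd EG g⁻¹ (θ.eval X) :=
  θ.equivariant X.proj g X.snd

/-- The orbit map of `z` is left translation by `g⁻¹` followed by the orbit map of `z g`; this moves
`Y` to the identity, where the form inverts `vert`. -/
theorem PrincipalConnection.eval_orbit [LieGroup 𝓘(ℝ, EG) ∞ G] (c : PrincipalConnection P)
    (z : P.carrier) (g : G) (Y : TangentSpace 𝓘(ℝ, EG) g) :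
    c.eval (tangentMap 𝓘(ℝ, EG) P.model (fun g => P.rsmul z g) ⟨g, Y⟩) = maurerCartan EG g Y := by
  have hc : (fun g => P.rsmul z g) = (fun h => P.rsmul (P.rsmul z g) h) ∘ fun x => g⁻¹ * x := by
    funext x
    simp only [Function.comp_apply]
    rw [← P.rsmul_mul, mul_inv_cancel_left]
  have hd : MDifferentiable 𝓘(ℝ, EG) 𝓘(ℝ, EG) fun x => g⁻¹ * x :=
    (contMDiff_mul_left (n := ∞)).mdifferentiable (by simp)
  rw [hc, tangentMap_comp ((P.contMDiff_rsmul_left _).mdifferentiable (by simp)) hd,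
    Function.comp_apply, ← mk_maurerCartan, ← P.mk_vert]
  exact c.form_vert _ _

end Principal

/-! ### The action on `E_K` and its infinitesimal form -/

section Equivariant

variable {EN : Type*} [NormedAddCommGroup EN] [NormedSpace ℝ EN]
  {N : Type u} [TopologicalSpace N] [ChartedSpace EN N] [Group N]
  {EA : Type*} [NormedAddCommGroup EA] [NormedSpace ℝ EA]
  {A : Type*} [TopologicalSpace A] [ChartedSpace EA A] [Group A]
  {EH : Type*} [NormedAddCommGroup EH] [NormedSpace ℝ EH]
  {H : Type u} [TopologicalSpace H] [ChartedSpace EH H] [Group H]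
  {φ : A →* MulAut N}
  {K : Subgroup H} {EK : Type*} [NormedAddCommGroup EK] [NormedSpace ℝ EK] [ChartedSpace EK K]

namespace EquivariantHermitianBundle

variable (E : EquivariantHermitianBundle EN EA EH φ K EK)

theorem incl_injective : Function.Injective E.incl :=
  E.isSmoothEmbedding_incl.isEmbedding.injective

theorem actK_mul (g g' : N ⋊[φ] A) (z : E.bundleK.carrier) :
    E.actK (g * g') z = E.actK g (E.actK g' z) :=
  E.incl_injective (by rw [E.incl_actK, E.incl_actK, E.incl_actK, E.act_mul])

theorem actK_rsmul (g : N ⋊[φ] A) (z : E.bundleK.carrier) (k : K) :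
    E.actK g (E.bundleK.rsmul z k) = E.bundleK.rsmul (E.actK g z) k :=
  E.incl_injective (by rw [E.incl_actK, E.incl_rsmul, E.incl_rsmul, E.incl_actK, E.act_rsmul])

theorem proj_actK (g : N ⋊[φ] A) (z : E.bundleK.carrier) :
    E.bundleK.proj (E.actK g z) = semidirectAct g (E.bundleK.proj z) := by
  rw [← E.proj_incl, E.incl_actK, E.proj_act, E.proj_incl]

/-- The action on `E_K` is defined by choice, but becomes the smooth action on `E_H` after composing
with the embedding `incl`. The embedding gives continuity, and a continuous map into an immersed
manifold is smooth when its composite with the immersion is. -/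
theorem contMDiff_actK :
    ContMDiff ((𝓘(ℝ, EN).prod 𝓘(ℝ, EA)).prod E.bundleK.model) E.bundleK.model ∞
      (fun p : (N × A) × E.bundleK.carrier => E.actK ⟨p.1.1, p.1.2⟩ p.2) := by
  have h : ContMDiff ((𝓘(ℝ, EN).prod 𝓘(ℝ, EA)).prod E.bundleK.model) E.bundleH.model ∞
      (E.incl ∘ fun p : (N × A) × E.bundleK.carrier => E.actK ⟨p.1.1, p.1.2⟩ p.2) :=
    (E.contMDiff_act.comp (contMDiff_fst.prodMk
      (E.isSmoothEmbedding_incl.contMDiff.comp contMDiff_snd))).congr fun p => E.incl_actK _ _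
  rw [ContMDiff.iff_comp_isImmersion E.isSmoothEmbedding_incl.isImmersion]
  exact ⟨E.isSmoothEmbedding_incl.isEmbedding.continuous_iff.2 h.continuous, h⟩

theorem contMDiff_actK_right (g : N ⋊[φ] A) :
    ContMDiff E.bundleK.model E.bundleK.model ∞ (E.actK g) :=
  E.contMDiff_actK.comp (contMDiff_const (c := (g.left, g.right)) |>.prodMk contMDiff_id)

theorem contMDiff_actK_inl (z : E.bundleK.carrier) :
    ContMDiff 𝓘(ℝ, EN) E.bundleK.model ∞
      (fun n : N => E.actK (SemidirectProduct.inl n) z) :=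
  E.contMDiff_actK.comp ((contMDiff_id.prodMk (contMDiff_const (c := (1 : A)))).prodMk
    contMDiff_const)

theorem contMDiff_actK_inr (z : E.bundleK.carrier) :
    ContMDiff 𝓘(ℝ, EA) E.bundleK.model ∞
      (fun a : A => E.actK (SemidirectProduct.inr a) z) :=
  E.contMDiff_actK.comp (((contMDiff_const (c := (1 : N))).prodMk contMDiff_id).prodMk
    contMDiff_const)

theorem proj_actK_inl {z : E.bundleK.carrier} (hz : E.bundleK.proj z = 1) (n : N) :
    E.bundleK.proj (E.actK (SemidirectProduct.inl n) z) = n := by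
  rw [E.proj_actK, hz]; simp [semidirectAct]

theorem proj_actK_inr {z : E.bundleK.carrier} (hz : E.bundleK.proj z = 1) (a : A) :
    E.bundleK.proj (E.actK (SemidirectProduct.inr a) z) = 1 := by
  rw [E.proj_actK, hz]; simp [semidirectAct]

theorem mk_delta (z : E.bundleK.carrier) (v : GroupLieAlgebra 𝓘(ℝ, EN) N) :
    (⟨z, E.delta z v⟩ : TangentBundle E.bundleK.model E.bundleK.carrier) =
      tangentMap 𝓘(ℝ, EN) E.bundleK.model
        (fun n : N => E.actK (SemidirectProduct.inl n) z) ⟨1, v⟩ :=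
  mk_castTangent _ _ _

/-- The orbit map `n ↦ n z` is a section of the projection when `z` lies over the identity. -/
theorem dproj_delta {z : E.bundleK.carrier} (hz : E.bundleK.proj z = 1)
    (v : GroupLieAlgebra 𝓘(ℝ, EN) N) :
    castTangent 𝓘(ℝ, EN) hz (E.bundleK.dproj z (E.delta z v)) = v := by
  suffices h : (⟨1, castTangent 𝓘(ℝ, EN) hz (E.bundleK.dproj z (E.delta z v))⟩ :
      TangentBundle 𝓘(ℝ, EN) N) = ⟨1, v⟩ from Bundle.TotalSpace.mk_inj.1 h
  rw [mk_castTangent]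
  have hp := E.bundleK.contMDiff_proj.mdifferentiable (by simp)
  have hd := (E.contMDiff_actK_inl z).mdifferentiable (by simp)
  have h := congrFun (tangentMap_comp hp hd) ⟨1, v⟩
  rw [Function.comp_apply, ← E.mk_delta] at h
  have hc : E.bundleK.proj ∘ (fun n : N => E.actK (SemidirectProduct.inl n) z) = id :=
    funext fun n => E.proj_actK_inl hz n
  rw [hc, tangentMap_id] at h
  exact h.symm

end EquivariantHermitianBundle

theorem EquivariantForm.IsInvariant.eval_actK {E : EquivariantHermitianBundle EN EA EH φ K EK}
    {θ : EquivariantForm E.bundleK} (h : θ.IsInvariant) (g : N ⋊[φ] A)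
    (X : TangentBundle E.bundleK.model E.bundleK.carrier) :
    θ.eval (tangentMap E.bundleK.model E.bundleK.model (E.actK g) X) = θ.eval X :=
  h g X.proj X.snd

/-! ### Reading a pair off a quadruple -/

namespace HermitianQuadruple

variable (Q : HermitianQuadruple EN EA EH φ K EK)

/-- The values of the connection form on the vectors `δ v` change under the action of `K` by the
adjoint action. -/
theorem form_delta_rsmul (z : Q.bundleK.carrier) (k : K) (v : GroupLieAlgebra 𝓘(ℝ, EN) N) :
    Q.conn.form (Q.bundleK.rsmul z k) (Q.delta (Q.bundleK.rsmul z k) v) =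
      lieAd EK k⁻¹ (Q.conn.form z (Q.delta z v)) := by
  change Q.conn.eval ⟨_, _⟩ = lieAd EK k⁻¹ (Q.conn.eval ⟨_, _⟩)
  have hc : (fun n : N => Q.actK (SemidirectProduct.inl n) (Q.bundleK.rsmul z k)) =
      (fun w => Q.bundleK.rsmul w k) ∘ fun n : N => Q.actK (SemidirectProduct.inl n) z :=
    funext fun n => Q.actK_rsmul _ _ _
  rw [Q.mk_delta, Q.mk_delta, hc,
    tangentMap_comp ((Q.bundleK.contMDiff_rsmul_right k).mdifferentiable (by simp))
      ((Q.contMDiff_actK_inl z).mdifferentiable (by simp)), Function.comp_apply,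
    Q.conn.eval_rsmul]

/-- Equivariance of the connection form along orbits of `N` under automorphisms. -/
theorem form_delta_actK_inr (z : Q.bundleK.carrier) (a : A)
    (hφ : ContMDiff 𝓘(ℝ, EN) 𝓘(ℝ, EN) ∞ (φ a)) (v : GroupLieAlgebra 𝓘(ℝ, EN) N) :
    Q.conn.form (Q.actK (SemidirectProduct.inr a) z)
        (Q.delta (Q.actK (SemidirectProduct.inr a) z) (lieMap EN EN (φ a).toMonoidHom v)) =
      Q.conn.form z (Q.delta z v) := by
  -- The relation `φ(a)(n) a = a n` in the semidirect product, applied to `z`.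
  have hc : (fun n : N => Q.actK (SemidirectProduct.inl n) (Q.actK (SemidirectProduct.inr a) z)) ∘
      (φ a).toMonoidHom =
      Q.actK (SemidirectProduct.inr a) ∘ fun n : N => Q.actK (SemidirectProduct.inl n) z := by
    funext n
    simp only [Function.comp_apply, ← Q.actK_mul]
    congr 1
    ext <;> simp
  have hφ' : MDifferentiable 𝓘(ℝ, EN) 𝓘(ℝ, EN) (φ a).toMonoidHom :=
    hφ.mdifferentiable (by simp)
  have h := congrArg (fun f => tangentMap 𝓘(ℝ, EN) Q.bundleK.model f ⟨1, v⟩) hc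
  beta_reduce at h
  rw [tangentMap_comp ((Q.contMDiff_actK_inl _).mdifferentiable (by simp)) hφ',
    tangentMap_comp ((Q.contMDiff_actK_right _).mdifferentiable (by simp))
      ((Q.contMDiff_actK_inl z).mdifferentiable (by simp)), Function.comp_apply,
    Function.comp_apply, tangentMap_one_eq, ← Q.mk_delta, ← Q.mk_delta] at h
  exact (congrArg Q.conn.eval h).trans (EquivariantForm.IsInvariant.eval_actK Q.invariant _ _)

variable {Q}

/-- Both `d' v` and `δ v` lift `v`, so their difference is vertical, and the connection form `θ`
identifies it: `θ(d' v - δ v) = -θ(δ v)`. This replaces the condition on horizontal lifts by an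
explicit formula for `ω`. -/
theorem readsOff_iff [IsManifold 𝓘(ℝ, EN) ∞ N] [LieGroup 𝓘(ℝ, EK) ∞ K] {z : Q.bundleK.carrier}
    {hz : Q.bundleK.proj z = 1} {p : InvariantPair EN EA φ EK K} :
    Q.ReadsOff z hz p ↔
      (∀ a : A, Q.actK (SemidirectProduct.inr a) z = Q.bundleK.rsmul z (p.β a)) ∧
        ∀ v, p.omega v = -Q.conn.form z (Q.delta z v) := by
  refine and_congr_right fun _ => ⟨fun h v => ?_, fun h X hX v hv => ?_⟩
  · set a := Q.conn.form z (Q.delta z v) with ha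
    -- The horizontal lift `d' v`, obtained by removing the vertical part of `δ v`.
    have hX : Q.delta z v - Q.bundleK.vert z a ∈ Q.conn.horizontal z := by
      change Q.conn.form z _ = 0
      rw [map_sub, Q.conn.form_vert, ← ha, sub_self]
    have h1 := congrArg (Q.conn.form z) (h _ hX v (by
      rw [map_sub, PrincipalBundle.dproj_vert, sub_zero, Q.dproj_delta hz]))
    rw [Q.conn.form_vert] at h1
    rw [← h1, map_sub, map_sub, Q.conn.form_vert, ← ha]
    abel
  · have hd : Q.bundleK.dproj z (X - Q.delta z v) = 0 := by
      have h0 : Function.Injective (castTangent 𝓘(ℝ, EN) hz) := by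
        clear hv h hX
        revert hz
        generalize Q.bundleK.proj z = y
        rintro rfl
        exact Function.injective_id
      apply h0
      rw [map_sub, map_sub, hv, Q.dproj_delta hz, sub_self, map_zero]
    obtain ⟨a, ha⟩ := PrincipalBundle.exists_vert_eq _ hd
    rw [← ha, h v]
    congr 1
    have h1 := congrArg (Q.conn.form z) ha
    rw [Q.conn.form_vert, map_sub] at h1
    have hX' : Q.conn.form z X = 0 := hX
    rw [h1, hX', zero_sub]

theorem _root_.InvariantPair.ext' {p p' : InvariantPair EN EA φ EK K} (h : ∀ a, p.β a = p'.β a)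
    (h' : ∀ v, p.omega v = p'.omega v) : p = p' := by
  obtain ⟨β, _, om, _⟩ := p
  obtain ⟨β', _, om', _⟩ := p'
  obtain rfl : β = β' := MonoidHom.ext h
  obtain rfl : om = om' := LinearMap.ext h'
  rfl

theorem Iso.toK_rsmul {Q' : HermitianQuadruple EN EA EH φ K EK} (f : Q.Iso Q')
    (z : Q.bundleK.carrier) (k : K) :
    f.toK (Q.bundleK.rsmul z k) = Q'.bundleK.rsmul (f.toK z) k :=
  Q'.incl_injective (by
    rw [f.incl_toK, Q.incl_rsmul, f.toH_rsmul, Q'.incl_rsmul, f.incl_toK])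

theorem Iso.toK_actK {Q' : HermitianQuadruple EN EA EH φ K EK} (f : Q.Iso Q')
    (g : N ⋊[φ] A) (z : Q.bundleK.carrier) : f.toK (Q.actK g z) = Q'.actK g (f.toK z) :=
  Q'.incl_injective (by
    rw [f.incl_toK, Q.incl_actK, f.toH_act, Q'.incl_actK, f.incl_toK])

theorem Iso.proj_toK {Q' : HermitianQuadruple EN EA EH φ K EK} (f : Q.Iso Q')
    (z : Q.bundleK.carrier) : Q'.bundleK.proj (f.toK z) = Q.bundleK.proj z := by
  rw [← Q'.proj_incl, f.incl_toK, f.proj_toH, Q.proj_incl]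

variable [IsManifold 𝓘(ℝ, EN) ∞ N] [LieGroup 𝓘(ℝ, EK) ∞ K]

/-- The fibre over the identity is preserved by `A`, and `K` acts on it simply transitively; this
defines `β`, which is multiplicative since the left and right actions commute. The form `ω` is `-θ ∘
δ`. -/
theorem exists_readsOff
    (hφ : ∀ a, ContMDiff 𝓘(ℝ, EN) 𝓘(ℝ, EN) ∞ (φ a)) (z : Q.bundleK.carrier)
    (hz : Q.bundleK.proj z = 1) : ∃ p : InvariantPair EN EA φ EK K, Q.ReadsOff z hz p := by
  choose β hβ using fun a : A =>
    Q.bundleK.exists_rsmul_eq ((Q.proj_actK_inr hz a).trans hz.symm)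
  have hmul (a b : A) : β (a * b) = β a * β b := by
    apply Q.bundleK.rsmul_injective z
    rw [← hβ, map_mul, Q.actK_mul, hβ b, Q.actK_rsmul, hβ a, Q.bundleK.rsmul_mul]
  let β' : A →* K := MonoidHom.mk' β hmul
  refine ⟨⟨β', ?_, ?_, ?_⟩, readsOff_iff.2 ⟨hβ, ?_⟩⟩
  · exact Q.bundleK.contMDiff_of_eq_rsmul contMDiff_const (Q.contMDiff_actK_inr z) hβ
  · exact -((Q.conn.form z).comp (Q.delta z) :
      GroupLieAlgebra 𝓘(ℝ, EN) N →ₗ[ℝ] GroupLieAlgebra 𝓘(ℝ, EK) K)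
  · intro a v
    change lieAd EK (β a) (-Q.conn.form z (Q.delta z _)) = -Q.conn.form z (Q.delta z v)
    -- Acting by `a⁻¹` at `a z = z β(a)` leads back to `z`. Hence `θ(δ(φ(a⁻¹) v))` at `z` equals
    -- `θ(δ v)` at `z β(a)`, which is `Ad(β(a)⁻¹)` of `θ(δ v)` at `z`.
    have h1 := Q.form_delta_actK_inr (Q.actK (SemidirectProduct.inr a) z) a⁻¹ (hφ _) v
    have h2 := Q.form_delta_rsmul z (β a) v
    rw [← hβ] at h2
    rw [← Q.actK_mul, ← map_mul, inv_mul_cancel, map_one, Q.actK_one, h2] at h1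
    rw [map_neg, h1, ← lieAd_mul, mul_inv_cancel, lieAd_one]
  · exact fun v => rfl

theorem existsUnique_readsOff
    (hφ : ∀ a, ContMDiff 𝓘(ℝ, EN) 𝓘(ℝ, EN) ∞ (φ a)) (z : Q.bundleK.carrier)
    (hz : Q.bundleK.proj z = 1) : ∃! p : InvariantPair EN EA φ EK K, Q.ReadsOff z hz p := by
  obtain ⟨p, hp⟩ := exists_readsOff hφ z hz
  refine ⟨p, hp, fun p' hp' => ?_⟩
  rw [readsOff_iff] at hp hp'
  refine InvariantPair.ext' (fun a => ?_) fun v => by rw [hp.2, hp'.2]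
  apply Q.bundleK.rsmul_injective z
  rw [← hp.1, ← hp'.1]

/-- Since `a (z k⁻¹) = z β(a) k⁻¹ = (z k⁻¹)(k β(a) k⁻¹)`, every pair equivalent to one that is read
off is read off at another point of the same fibre. -/
theorem ReadsOff.rsmul {z : Q.bundleK.carrier} {hz : Q.bundleK.proj z = 1}
    {p p' : InvariantPair EN EA φ EK K} (h : Q.ReadsOff z hz p) (k : K)
    (hβ : ∀ a, p'.β a = k * p.β a * k⁻¹) (ho : ∀ v, p'.omega v = lieAd EK k (p.omega v)) :
    Q.ReadsOff (Q.bundleK.rsmul z k⁻¹) ((Q.bundleK.proj_rsmul _ _).trans hz) p' := by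
  rw [readsOff_iff] at h ⊢
  refine ⟨fun a => ?_, fun v => ?_⟩
  · rw [Q.actK_rsmul, h.1, hβ, ← Q.bundleK.rsmul_mul, ← Q.bundleK.rsmul_mul]
    congr 1
    group
  · rw [ho, h.2, form_delta_rsmul, inv_inv, map_neg]

/-- Two points over the identity differ by some `k`, and passing from `z` to `z k` conjugates the
pair by `k⁻¹`. -/
theorem ReadsOff.isEquivalent {z z' : Q.bundleK.carrier} {hz : Q.bundleK.proj z = 1}
    {hz' : Q.bundleK.proj z' = 1} {p p' : InvariantPair EN EA φ EK K}
    (h : Q.ReadsOff z hz p) (h' : Q.ReadsOff z' hz' p') : p.IsEquivalent p' := by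
  obtain ⟨k, rfl⟩ := Q.bundleK.exists_rsmul_eq (hz'.trans hz.symm)
  rw [readsOff_iff] at h h'
  refine ⟨k⁻¹, fun a => ?_, fun v => ?_⟩
  · apply Q.bundleK.rsmul_injective (Q.bundleK.rsmul z k)
    rw [← h'.1, Q.actK_rsmul, h.1, ← Q.bundleK.rsmul_mul, ← Q.bundleK.rsmul_mul]
    congr 1
    group
  · rw [h.2, h'.2, form_delta_rsmul, map_neg]

theorem ReadsOff.map_iso {Q' : HermitianQuadruple EN EA EH φ K EK} (f : Q.Iso Q')
    {z : Q.bundleK.carrier} {hz : Q.bundleK.proj z = 1} {p : InvariantPair EN EA φ EK K}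
    (h : Q.ReadsOff z hz p) : Q'.ReadsOff (f.toK z) ((f.proj_toK z).trans hz) p := by
  rw [readsOff_iff] at h ⊢
  refine ⟨fun a => by rw [← f.toK_actK, h.1, f.toK_rsmul], fun v => ?_⟩
  rw [h.2]
  congr 1
  have hd : MDifferentiable Q.bundleK.model Q'.bundleK.model f.toK :=
    f.toK.contMDiff.mdifferentiable (by simp)
  have hc : (fun n : N => Q'.actK (SemidirectProduct.inl n) (f.toK z)) =
      f.toK ∘ fun n : N => Q.actK (SemidirectProduct.inl n) z :=
    funext fun n => (f.toK_actK _ _).symm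
  have h1 := Q'.mk_delta (f.toK z) v
  rw [hc, tangentMap_comp hd ((Q.contMDiff_actK_inl z).mdifferentiable (by simp)),
    Function.comp_apply, ← Q.mk_delta] at h1
  rw [← f.conn_toK z]
  exact congrArg Q'.conn.eval h1.symm

theorem isEquivalent_of_isIsomorphic
    {Q Q' : HermitianQuadruple EN EA EH φ K EK} (h : Q.IsIsomorphic Q')
    {z : Q.bundleK.carrier} {hz : Q.bundleK.proj z = 1} {z' : Q'.bundleK.carrier}
    {hz' : Q'.bundleK.proj z' = 1} {p p' : InvariantPair EN EA φ EK K}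
    (hp : Q.ReadsOff z hz p) (hp' : Q'.ReadsOff z' hz' p') : p.IsEquivalent p' := by
  obtain ⟨f⟩ := h
  exact (hp.map_iso f).isEquivalent hp'

/-- The point is the class `q 1 1`. There `a [1, 1] = [a, 1] = [1, β(a)]`, and `δ v` is tangent to
the leaf `N`, hence horizontal for the flat connection. So `δ v` plus the vertical vector of `ω v`
is horizontal for the sum, which is `ω = d' - δ`. -/
theorem IsConstructedFrom.exists_readsOff {p : InvariantPair EN EA φ EK K}
    (h : Q.IsConstructedFrom p) : ∃ z hz, Q.ReadsOff z hz p := by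
  obtain ⟨q, hq, c', α, hc', -, hα, hsum⟩ := h
  refine ⟨q 1 1, hq.proj_one, readsOff_iff.2 ⟨fun a => ?_, fun v => ?_⟩⟩
  · rw [hq.actK_eq, hq.rsmul_eq, hq.eq_iff]
    exact ⟨a⁻¹, by simp, by simp⟩
  · have hX : Q.delta (q 1 1) v ∈ c'.horizontal (q 1 1) := by
      have h0 := hc' 1 1 v
      change c'.eval ⟨_, _⟩ = 0 at h0
      change c'.eval ⟨_, _⟩ = 0
      rw [Q.mk_delta]
      refine Eq.trans (congrArg c'.eval ?_) h0
      have hf : (fun n : N => Q.actK (SemidirectProduct.inl n) (q 1 1)) =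
          fun n : N => q (1 * SemidirectProduct.inl n) 1 := by
        funext n
        rw [hq.actK_eq, mul_one, one_mul]
      rw [hf]
      rfl
    have h1 : Q.conn.form _ _ = 0 := hsum _ _ hX
    rw [map_add, Q.conn.form_vert, hα, Q.dproj_delta hq.proj_one] at h1
    exact eq_neg_of_add_eq_zero_right h1

end HermitianQuadruple

end Equivariant

/-! ### Transformation rules of the Maurer–Cartan form -/

section MaurerCartan

variable {E : Type*} [NormedAddCommGroup E] [NormedSpace ℝ E]
  {G : Type*} [TopologicalSpace G] [ChartedSpace E G] [Group G]
  {E' : Type*} [NormedAddCommGroup E'] [NormedSpace ℝ E']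
  {G' : Type*} [TopologicalSpace G'] [ChartedSpace E' G'] [Group G']
  {EM : Type*} [NormedAddCommGroup EM] [NormedSpace ℝ EM] {M₀ : Type*} [TopologicalSpace M₀]
  {I : ModelWithCorners ℝ EM M₀} {M : Type*} [TopologicalSpace M] [ChartedSpace M₀ M]

/-- The Maurer–Cartan form as a function on the tangent bundle. -/
def maurerCartanEval (X : TangentBundle 𝓘(ℝ, E) G) : GroupLieAlgebra 𝓘(ℝ, E) G :=
  maurerCartan E X.proj X.snd

theorem mk_maurerCartanEval (X : TangentBundle 𝓘(ℝ, E) G) :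
    (⟨1, maurerCartanEval X⟩ : TangentBundle 𝓘(ℝ, E) G) =
      tangentMap 𝓘(ℝ, E) 𝓘(ℝ, E) (fun x => X.proj⁻¹ * x) X :=
  mk_maurerCartan _ _

/-- Values are compared as elements of the tangent bundle, where the chain rule needs no transport
between fibres. -/
theorem maurerCartanEval_eq {X : TangentBundle 𝓘(ℝ, E) G} {v : GroupLieAlgebra 𝓘(ℝ, E) G}
    (h : tangentMap 𝓘(ℝ, E) 𝓘(ℝ, E) (fun x => X.proj⁻¹ * x) X = ⟨1, v⟩) :
    maurerCartanEval X = v := by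
  have h' := (mk_maurerCartanEval X).trans h
  rw [Bundle.TotalSpace.mk_inj] at h'
  exact h'

theorem maurerCartanEval_one (v : GroupLieAlgebra 𝓘(ℝ, E) G) :
    maurerCartanEval ⟨1, v⟩ = v := by
  apply maurerCartanEval_eq
  have : (fun x : G => (1 : G)⁻¹ * x) = id := by funext x; simp
  change tangentMap 𝓘(ℝ, E) 𝓘(ℝ, E) (fun x : G => (1 : G)⁻¹ * x) ⟨1, v⟩ = ⟨1, v⟩
  rw [this, tangentMap_id]
  rfl

theorem maurerCartanEval_tangentMap_const (g : G) (X : TangentBundle I M) :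
    maurerCartanEval (tangentMap I 𝓘(ℝ, E) (fun _ => g) X) = 0 := by
  simp only [maurerCartanEval, tangentMap, mfderiv_const]
  exact (maurerCartan E g).map_zero

variable [LieGroup 𝓘(ℝ, E) ∞ G]

theorem ContMDiff.maurerCartanEval_tangentMap [IsManifold I ∞ M] {f : M → G}
    (hf : ContMDiff I 𝓘(ℝ, E) ∞ f) : ContMDiff (M' := E) I.tangent 𝓘(ℝ, E) ∞
      (fun X : TangentBundle I M => maurerCartanEval (tangentMap I 𝓘(ℝ, E) f X)) := by
  have h1 : ContMDiff I.tangent 𝓘(ℝ, E).tangent ∞ (tangentMap I 𝓘(ℝ, E) f) :=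
    hf.contMDiff_tangentMap (m := ∞) le_rfl
  exact ContMDiff.comp (I' := 𝓘(ℝ, E).tangent) (E'' := E) (H'' := E) (M'' := E)
    (g := fun X : TangentBundle 𝓘(ℝ, E) G => maurerCartan E X.proj X.snd)
    contMDiff_maurerCartan h1

theorem ContMDiff.lieAd_inv_apply {V : Type*} [NormedAddCommGroup V] [NormedSpace ℝ V]
    (L : V →L[ℝ] GroupLieAlgebra 𝓘(ℝ, E) G) {f : M → V} {g : M → G}
    (hf : ContMDiff I 𝓘(ℝ, V) ∞ f) (hg : ContMDiff I 𝓘(ℝ, E) ∞ g) :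
    ContMDiff (M' := E) I 𝓘(ℝ, E) ∞ (fun m => lieAd E (g m)⁻¹ (L (f m))) := by
  have h : ContMDiff (M' := E) 𝓘(ℝ, V) 𝓘(ℝ, E) ∞ L :=
    (ContinuousLinearMap.contDiff (F := E) L).contMDiff
  have h1 : ContMDiff (M' := E) I 𝓘(ℝ, E) ∞ (fun m => L (f m)) := h.comp hf
  have h2 : ContMDiff (M' := G × E) I (𝓘(ℝ, E).prod 𝓘(ℝ, E)) ∞
      (fun m => ((g m)⁻¹, (L (f m) : E))) := hg.inv.prodMk h1
  have h3 := (contMDiff_lieAd (E := E) (G := G)).comp h2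
  exact h3

theorem mdifferentiable_mul_left' (g : G) :
    MDifferentiable 𝓘(ℝ, E) 𝓘(ℝ, E) (fun x : G => g * x) :=
  (contMDiff_mul_left (n := ∞)).mdifferentiable (by simp)

theorem mdifferentiable_mul_right' (g : G) :
    MDifferentiable 𝓘(ℝ, E) 𝓘(ℝ, E) (fun x : G => x * g) :=
  (contMDiff_mul_right (n := ∞)).mdifferentiable (by simp)

/-- This rule and the next two differentiate, in `y` at `y = x`, the identities `(g x)⁻¹ (g y) = x⁻¹
y`, `(x g)⁻¹ (y g) = g⁻¹ (x⁻¹ y) g` and `f(x)⁻¹ f(y) = f(x⁻¹ y)`. -/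
theorem maurerCartanEval_mul_left (g : G) (X : TangentBundle 𝓘(ℝ, E) G) :
    maurerCartanEval (tangentMap 𝓘(ℝ, E) 𝓘(ℝ, E) (fun x => g * x) X) = maurerCartanEval X := by
  apply maurerCartanEval_eq
  have hc : (fun x => (g * X.proj)⁻¹ * x) ∘ (fun x => g * x) = fun x => X.proj⁻¹ * x := by
    funext x; simp [mul_assoc]
  have h := congrFun (tangentMap_comp (mdifferentiable_mul_left' (E := E) (g * X.proj)⁻¹)
    (mdifferentiable_mul_left' (E := E) g)) X
  rw [hc, ← mk_maurerCartanEval] at h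
  exact h.symm

theorem maurerCartanEval_mul_right (g : G) (X : TangentBundle 𝓘(ℝ, E) G) :
    maurerCartanEval (tangentMap 𝓘(ℝ, E) 𝓘(ℝ, E) (fun x => x * g) X) =
      lieAd E g⁻¹ (maurerCartanEval X) := by
  apply maurerCartanEval_eq
  have hconj : MDifferentiable 𝓘(ℝ, E) 𝓘(ℝ, E) (MulAut.conj g⁻¹).toMonoidHom :=
    ContMDiff.mdifferentiable (n := ∞) (f := fun x : G => g⁻¹ * x * g⁻¹⁻¹)
      ((contMDiff_const.mul contMDiff_id).mul contMDiff_const) (by simp)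
  have hc : (fun x => (X.proj * g)⁻¹ * x) ∘ (fun x => x * g) =
      (MulAut.conj g⁻¹).toMonoidHom ∘ fun x => X.proj⁻¹ * x := by
    funext x; simp [mul_assoc]
  have h := congrFun (tangentMap_comp (mdifferentiable_mul_left' (E := E) (X.proj * g)⁻¹)
    (mdifferentiable_mul_right' (E := E) g)) X
  rw [hc, tangentMap_comp hconj (mdifferentiable_mul_left' _), Function.comp_apply,
    ← mk_maurerCartanEval, tangentMap_one_eq] at h
  exact h.symm

theorem maurerCartanEval_map [LieGroup 𝓘(ℝ, E') ∞ G'] {f : G →* G'}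
    (hf : ContMDiff 𝓘(ℝ, E) 𝓘(ℝ, E') ∞ f) (X : TangentBundle 𝓘(ℝ, E) G) :
    maurerCartanEval (tangentMap 𝓘(ℝ, E) 𝓘(ℝ, E') f X) = lieMap E E' f (maurerCartanEval X) := by
  apply maurerCartanEval_eq
  have hf' : MDifferentiable 𝓘(ℝ, E) 𝓘(ℝ, E') f := hf.mdifferentiable (by simp)
  have hc : (fun x => (f X.proj)⁻¹ * x) ∘ f = f ∘ fun x => X.proj⁻¹ * x := by
    funext x; simp
  have h := congrFun (tangentMap_comp (mdifferentiable_mul_left' (E := E') (f X.proj)⁻¹) hf') X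
  rw [hc, tangentMap_comp hf' (mdifferentiable_mul_left' _), Function.comp_apply,
    ← mk_maurerCartanEval, tangentMap_one_eq] at h
  exact h.symm

end MaurerCartan

/-! ### The flat connection and invariant adjoint forms on a trivial bundle -/

section Trivial

namespace PrincipalBundle

variable {EB : Type*} [NormedAddCommGroup EB] [NormedSpace ℝ EB]
  {B : Type*} [TopologicalSpace B] [ChartedSpace EB B]
  {EG : Type*} [NormedAddCommGroup EG] [NormedSpace ℝ EG]
  {G : Type*} [TopologicalSpace G] [ChartedSpace EG G]

theorem mdifferentiable_fst : MDifferentiable (𝓘(ℝ, EB).prod 𝓘(ℝ, EG)) 𝓘(ℝ, EB)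
    (Prod.fst : B × G → B) :=
  (contMDiff_fst (n := ∞)).mdifferentiable (by simp)

theorem mdifferentiable_snd : MDifferentiable (𝓘(ℝ, EB).prod 𝓘(ℝ, EG)) 𝓘(ℝ, EG)
    (Prod.snd : B × G → G) :=
  (contMDiff_snd (n := ∞)).mdifferentiable (by simp)

end PrincipalBundle

variable {EB : Type*} [NormedAddCommGroup EB] [NormedSpace ℝ EB]
  {B : Type u} [TopologicalSpace B] [ChartedSpace EB B]
  {EG : Type*} [NormedAddCommGroup EG] [NormedSpace ℝ EG]
  {G : Type u} [TopologicalSpace G] [ChartedSpace EG G] [Group G]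

/-- The connection `c' + α`. -/
def PrincipalConnection.add {P : PrincipalBundle EB B EG G} (c' : PrincipalConnection P)
    (α : AdjointForm P) : PrincipalConnection P where
  -- The minus sign comes from the convention for horizontal lifts: the form must vanish on `X +
  -- vert (α X)` when `c'` vanishes on `X`.
  form z := c'.form z - α.form z
  smooth := c'.smooth.sub α.smooth
  equivariant z g X := by
    simp only [sub_apply, map_sub, c'.equivariant, α.equivariant]
  form_vert z a := by
    rw [sub_apply, c'.form_vert, α.form_vert, sub_zero]

theorem PrincipalConnection.isSum_add {P : PrincipalBundle EB B EG G}
    (c' : PrincipalConnection P) (α : AdjointForm P) : (c'.add α).IsSum c' α := by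
  intro z X hX
  have hX' : c'.form z X = 0 := hX
  change (c'.form z - α.form z) _ = 0
  rw [sub_apply, map_add, map_add, c'.form_vert, α.form_vert, hX']
  abel

variable [IsManifold 𝓘(ℝ, EB) ∞ B] [LieGroup 𝓘(ℝ, EG) ∞ G]

variable (EB B EG G) in
/-- The trivial principal bundle. -/
@[reducible] def PrincipalBundle.trivial : PrincipalBundle EB B EG G where
  carrier := B × G
  proj := Prod.fst
  rsmul z g := (z.1, z.2 * g)
  contMDiff_proj := contMDiff_fst
  contMDiff_rsmul := contMDiff_fst.fst.prodMk (contMDiff_fst.snd.mul contMDiff_snd)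
  rsmul_one _ := by simp
  rsmul_mul _ _ _ := by simp [mul_assoc]
  proj_rsmul _ _ := rfl
  locally_trivial b := ⟨Set.univ, isOpen_univ, Set.mem_univ _, OpenPartialHomeomorph.refl _,
    by simp, by simp, contMDiffOn_id, contMDiffOn_id, fun _ _ => rfl, fun _ _ _ => rfl⟩

namespace PrincipalBundle

variable (EB B EG G) in
/-- The value of the flat connection form of the trivial bundle. -/
def trivialFlatForm (z : B × G) :
    TangentSpace (𝓘(ℝ, EB).prod 𝓘(ℝ, EG)) z →L[ℝ] GroupLieAlgebra 𝓘(ℝ, EG) G :=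
  (maurerCartan EG z.2).comp (mfderiv (𝓘(ℝ, EB).prod 𝓘(ℝ, EG)) 𝓘(ℝ, EG) Prod.snd z)

theorem contMDiff_trivialFlatForm :
    ContMDiff (M' := EG) (𝓘(ℝ, EB).prod 𝓘(ℝ, EG)).tangent 𝓘(ℝ, EG) ∞
      (fun X : TangentBundle (𝓘(ℝ, EB).prod 𝓘(ℝ, EG)) (B × G) =>
        maurerCartanEval (tangentMap (𝓘(ℝ, EB).prod 𝓘(ℝ, EG)) 𝓘(ℝ, EG) Prod.snd X)) := by
  have h : ContMDiff (𝓘(ℝ, EB).prod 𝓘(ℝ, EG)) 𝓘(ℝ, EG) ∞ (Prod.snd : B × G → G) := contMDiff_snd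
  exact h.maurerCartanEval_tangentMap

variable (EB B EG G) in
/-- The flat connection on the trivial bundle. -/
def trivialFlat : PrincipalConnection (PrincipalBundle.trivial EB B EG G) where
  form z := trivialFlatForm EB B EG G z
  smooth := contMDiff_trivialFlatForm
  equivariant z g X := by
    have h1 : ∀ Y : TangentBundle (𝓘(ℝ, EB).prod 𝓘(ℝ, EG)) (B × G), maurerCartanEval
        (tangentMap (𝓘(ℝ, EB).prod 𝓘(ℝ, EG)) 𝓘(ℝ, EG) Prod.snd
          (tangentMap (𝓘(ℝ, EB).prod 𝓘(ℝ, EG)) (𝓘(ℝ, EB).prod 𝓘(ℝ, EG))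
            (fun w => (PrincipalBundle.trivial EB B EG G).rsmul w g) Y)) =
        lieAd EG g⁻¹ (maurerCartanEval
          (tangentMap (𝓘(ℝ, EB).prod 𝓘(ℝ, EG)) 𝓘(ℝ, EG) Prod.snd Y)) := fun Y => by
      have h := congrFun (tangentMap_comp mdifferentiable_snd
        (((PrincipalBundle.trivial EB B EG G).contMDiff_rsmul_right g).mdifferentiable
          (by simp))) Y
      rw [Function.comp_apply] at h
      rw [← maurerCartanEval_mul_right, ← Function.comp_apply
        (f := tangentMap 𝓘(ℝ, EG) 𝓘(ℝ, EG) (fun x => x * g)),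
        ← tangentMap_comp (mdifferentiable_mul_right' _) mdifferentiable_snd]
      exact congrArg maurerCartanEval h.symm
    exact h1 ⟨z, X⟩
  form_vert z a := by
    change maurerCartanEval (tangentMap (𝓘(ℝ, EB).prod 𝓘(ℝ, EG)) 𝓘(ℝ, EG) Prod.snd
      ⟨z, (PrincipalBundle.trivial EB B EG G).vert z a⟩) = a
    have h := congrFun (tangentMap_comp mdifferentiable_snd
        (((PrincipalBundle.trivial EB B EG G).contMDiff_rsmul_left z).mdifferentiable
          (by simp))) ⟨1, a⟩
    rw [Function.comp_apply, ← mk_vert] at h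
    refine (congrArg maurerCartanEval h.symm).trans ?_
    exact (maurerCartanEval_mul_left z.2 ⟨1, a⟩).trans (maurerCartanEval_one a)

variable {EN : Type*} [NormedAddCommGroup EN] [NormedSpace ℝ EN]
  {N : Type u} [TopologicalSpace N] [ChartedSpace EN N] [Group N] [LieGroup 𝓘(ℝ, EN) ∞ N]

/-- The value of the invariant adjoint form on the trivial bundle over a Lie group `N` given by a
linear map `Lie(N) → Lie(G)`. -/
def trivialAdjointFormAt (L : GroupLieAlgebra 𝓘(ℝ, EN) N →L[ℝ] GroupLieAlgebra 𝓘(ℝ, EG) G)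
    (z : N × G) : TangentSpace (𝓘(ℝ, EN).prod 𝓘(ℝ, EG)) z →L[ℝ] GroupLieAlgebra 𝓘(ℝ, EG) G :=
  (lieAd EG z.2⁻¹).comp (L.comp ((maurerCartan EN z.1).comp
    (mfderiv (𝓘(ℝ, EN).prod 𝓘(ℝ, EG)) 𝓘(ℝ, EN) Prod.fst z)))

theorem contMDiff_trivialAdjointFormAt
    (L : GroupLieAlgebra 𝓘(ℝ, EN) N →L[ℝ] GroupLieAlgebra 𝓘(ℝ, EG) G) :
    ContMDiff (M' := EG) (𝓘(ℝ, EN).prod 𝓘(ℝ, EG)).tangent 𝓘(ℝ, EG) ∞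
      (fun X : TangentBundle (𝓘(ℝ, EN).prod 𝓘(ℝ, EG)) (N × G) => lieAd EG X.proj.2⁻¹ (L
        (maurerCartanEval (tangentMap (𝓘(ℝ, EN).prod 𝓘(ℝ, EG)) 𝓘(ℝ, EN) Prod.fst X)))) := by
  have h : ContMDiff (𝓘(ℝ, EN).prod 𝓘(ℝ, EG)) 𝓘(ℝ, EN) ∞ (Prod.fst : N × G → N) := contMDiff_fst
  have h1 := h.maurerCartanEval_tangentMap
  have h3 : ContMDiff (𝓘(ℝ, EN).prod 𝓘(ℝ, EG)).tangent 𝓘(ℝ, EG) ∞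
      (fun X : TangentBundle (𝓘(ℝ, EN).prod 𝓘(ℝ, EG)) (N × G) => X.proj.2) :=
    contMDiff_snd.comp (Bundle.contMDiff_proj _)
  exact ContMDiff.lieAd_inv_apply (V := EN) L h1 h3

/-- The invariant adjoint form on the trivial bundle over a Lie group `N` given by a linear map
`Lie(N) → Lie(G)`. -/
def trivialAdjointForm (L : GroupLieAlgebra 𝓘(ℝ, EN) N →L[ℝ] GroupLieAlgebra 𝓘(ℝ, EG) G) :
    AdjointForm (PrincipalBundle.trivial EN N EG G) where
  form z := trivialAdjointFormAt L z
  smooth := contMDiff_trivialAdjointFormAt L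
  equivariant z g X := by
    have h := congrFun (tangentMap_comp mdifferentiable_fst
      (((PrincipalBundle.trivial EN N EG G).contMDiff_rsmul_right g).mdifferentiable
        (by simp))) ⟨z, X⟩
    change lieAd EG (z.2 * g)⁻¹ (L (maurerCartanEval (tangentMap _ _ Prod.fst
      (tangentMap (𝓘(ℝ, EN).prod 𝓘(ℝ, EG)) (𝓘(ℝ, EN).prod 𝓘(ℝ, EG))
        (fun w => (PrincipalBundle.trivial EN N EG G).rsmul w g) ⟨z, X⟩)))) =
      lieAd EG g⁻¹ (lieAd EG z.2⁻¹ (L (maurerCartanEval (tangentMap _ _ Prod.fst ⟨z, X⟩))))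
    -- Right translation leaves the component in `N` unchanged and only alters the factor `Ad(k⁻¹)`.
    rw [← lieAd_mul, mul_inv_rev]
    exact congrArg (fun Y => lieAd EG (g⁻¹ * z.2⁻¹) (L (maurerCartanEval Y))) h.symm
  form_vert z a := by
    have h := congrFun (tangentMap_comp mdifferentiable_fst
        (((PrincipalBundle.trivial EN N EG G).contMDiff_rsmul_left z).mdifferentiable
          (by simp))) ⟨1, a⟩
    rw [Function.comp_apply, ← mk_vert] at h
    change lieAd EG z.2⁻¹ (L (maurerCartanEval (tangentMap _ _ Prod.fst
      ⟨z, (PrincipalBundle.trivial EN N EG G).vert z a⟩))) = 0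
    have h0 := (congrArg maurerCartanEval h.symm).trans
      (maurerCartanEval_tangentMap_const z.1 ⟨1, a⟩)
    rw [h0, map_zero, map_zero]

theorem trivialAdjointForm_eval
    (L : GroupLieAlgebra 𝓘(ℝ, EN) N →L[ℝ] GroupLieAlgebra 𝓘(ℝ, EG) G)
    (X : TangentBundle (𝓘(ℝ, EN).prod 𝓘(ℝ, EG)) (N × G)) :
    (trivialAdjointForm L).eval X = lieAd EG X.proj.2⁻¹ (L (maurerCartanEval
      (tangentMap (𝓘(ℝ, EN).prod 𝓘(ℝ, EG)) 𝓘(ℝ, EN) Prod.fst X))) := rfl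

theorem trivialFlat_eval (X : TangentBundle (𝓘(ℝ, EB).prod 𝓘(ℝ, EG)) (B × G)) :
    (trivialFlat EB B EG G).eval X =
      maurerCartanEval (tangentMap (𝓘(ℝ, EB).prod 𝓘(ℝ, EG)) 𝓘(ℝ, EG) Prod.snd X) := rfl

end PrincipalBundle

end Trivial

section Section

variable {E : Type*} [NormedAddCommGroup E] [NormedSpace ℝ E] {X : Type*} [TopologicalSpace X]
  {I : ModelWithCorners ℝ E X} {M : Type*} [TopologicalSpace M] [ChartedSpace X M]
  {E' : Type*} [NormedAddCommGroup E'] [NormedSpace ℝ E'] {X' : Type*} [TopologicalSpace X']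
  {I' : ModelWithCorners ℝ E' X'} {M' : Type*} [TopologicalSpace M'] [ChartedSpace X' M']

/-- The differential of `s` at `f x` is a right inverse of that of `f`; the condition `s (f x) = x`
makes it take values in the tangent space at the given point `x`. -/
theorem mfderiv_surjective_of_rightInverse {f : M → M'} {s : M' → M} {x : M}
    (hf : MDifferentiableAt I I' f x) (hs : MDifferentiableAt I' I s (f x)) (hx : s (f x) = x)
    (h : Function.RightInverse s f) : Function.Surjective (mfderiv I I' f x) := by
  intro Y
  obtain ⟨⟨x', w⟩, rfl, hw⟩ : ∃ W : TangentBundle I M, W.proj = x ∧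
      tangentMap I I' f W = ⟨f x, Y⟩ := by
    refine ⟨tangentMap I' I s ⟨f x, Y⟩, hx, ?_⟩
    rw [← tangentMap_comp_at _ (by rw [← hx] at hf; exact hf) hs, h.id, tangentMap_id, id]
  exact ⟨w, Bundle.TotalSpace.mk_inj.1 hw⟩

end Section

/-! ### The model quadruple of a pair on `N × K ⊆ N × H` -/

section Model

variable {EN : Type*} [NormedAddCommGroup EN] [NormedSpace ℝ EN]
  {N : Type u} [TopologicalSpace N] [ChartedSpace EN N] [Group N] [LieGroup 𝓘(ℝ, EN) ∞ N]
  {EA : Type*} [NormedAddCommGroup EA] [NormedSpace ℝ EA]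
  {A : Type*} [TopologicalSpace A] [ChartedSpace EA A] [Group A]
  {EH : Type*} [NormedAddCommGroup EH] [NormedSpace ℝ EH]
  {H : Type u} [TopologicalSpace H] [ChartedSpace EH H] [Group H] [LieGroup 𝓘(ℝ, EH) ∞ H]
  {φ : A →* MulAut N}
  {K : Subgroup H} {EK : Type*} [NormedAddCommGroup EK] [NormedSpace ℝ EK] [ChartedSpace EK K]
  [LieGroup 𝓘(ℝ, EK) ∞ K]

theorem contMDiff_semidirect_smul {EG : Type*} [NormedAddCommGroup EG] [NormedSpace ℝ EG]
    {G : Type*} [TopologicalSpace G] [ChartedSpace EG G] [Group G] [LieGroup 𝓘(ℝ, EG) ∞ G]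
    (hφ : ContMDiff (𝓘(ℝ, EA).prod 𝓘(ℝ, EN)) 𝓘(ℝ, EN) ∞ (fun p : A × N => φ p.1 p.2))
    {γ : A →* G} (hγ : ContMDiff 𝓘(ℝ, EA) 𝓘(ℝ, EG) ∞ γ) :
    ContMDiff ((𝓘(ℝ, EN).prod 𝓘(ℝ, EA)).prod (𝓘(ℝ, EN).prod 𝓘(ℝ, EG)))
      (𝓘(ℝ, EN).prod 𝓘(ℝ, EG)) ∞
      (fun p : (N × A) × (N × G) => (p.1.1 * φ p.1.2 p.2.1, γ p.1.2 * p.2.2)) := by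
  have h1 : ContMDiff ((𝓘(ℝ, EN).prod 𝓘(ℝ, EA)).prod (𝓘(ℝ, EN).prod 𝓘(ℝ, EG)))
      𝓘(ℝ, EN) ∞ (fun p : (N × A) × (N × G) => φ p.1.2 p.2.1) :=
    hφ.comp (contMDiff_fst.snd.prodMk contMDiff_snd.fst)
  have h2 : ContMDiff ((𝓘(ℝ, EN).prod 𝓘(ℝ, EA)).prod (𝓘(ℝ, EN).prod 𝓘(ℝ, EG)))
      𝓘(ℝ, EG) ∞ (fun p : (N × A) × (N × G) => γ p.1.2) :=
    hγ.comp contMDiff_fst.snd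
  exact (contMDiff_fst.fst.mul h1).prodMk (h2.mul contMDiff_snd.snd)

variable (hφ : ContMDiff (𝓘(ℝ, EA).prod 𝓘(ℝ, EN)) 𝓘(ℝ, EN) ∞ (fun p : A × N => φ p.1 p.2))
  (hK : Manifold.IsSmoothEmbedding 𝓘(ℝ, EK) 𝓘(ℝ, EH) ∞ (Subtype.val : K → H))

/-- The equivariant hermitian bundle `N × K ⊆ N × H` in which `(u, a)` acts by
`(v, h) ↦ (u φ(a)(v), β(a) h)`. -/
@[reducible] def EquivariantHermitianBundle.ofHom (β : A →* K)
    (hβ : ContMDiff 𝓘(ℝ, EA) 𝓘(ℝ, EK) ∞ β) : EquivariantHermitianBundle EN EA EH φ K EK where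
  bundleH := PrincipalBundle.trivial EN N EH H
  bundleK := PrincipalBundle.trivial EN N EK K
  incl := Prod.map id Subtype.val
  isSmoothEmbedding_incl := Manifold.IsSmoothEmbedding.id.prodMap hK
  proj_incl _ := rfl
  incl_rsmul _ _ := rfl
  act g z := (g.left * φ g.right z.1, β g.right * z.2)
  act_one z := by simp
  act_mul g g' z := by simp [mul_assoc]
  contMDiff_act := contMDiff_semidirect_smul (γ := K.subtype.comp β) hφ (hK.contMDiff.comp hβ)
  proj_act _ _ := rfl
  act_rsmul _ _ _ := by simp [mul_assoc]
  act_incl := by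
    refine Set.Subset.antisymm ?_ fun w hw => ⟨(1, w), ⟨trivial, hw⟩, by simp⟩
    rintro _ ⟨⟨g, _⟩, ⟨-, ⟨z, rfl⟩⟩, rfl⟩
    exact ⟨(g.left * φ g.right z.1, β g.right * z.2), by simp⟩

theorem EquivariantHermitianBundle.actK_ofHom {β : A →* K}
    (hβ : ContMDiff 𝓘(ℝ, EA) 𝓘(ℝ, EK) ∞ β) (g : N ⋊[φ] A) (z : N × K) :
    (ofHom hφ hK β hβ).actK g z = (g.left * φ g.right z.1, β g.right * z.2) :=
  (ofHom hφ hK β hβ).incl_injective (by rw [incl_actK]; simp)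

/-- The quotient map sends `(g, k)` to `g` applied to the point `(1, k)`. Two pairs have the same
image exactly when they differ by `a = g₁.right⁻¹ * g₂.right`. -/
theorem EquivariantHermitianBundle.isAssociatedBundle_ofHom [LieGroup 𝓘(ℝ, EA) ∞ A] {β : A →* K}
    (hβ : ContMDiff 𝓘(ℝ, EA) 𝓘(ℝ, EK) ∞ β) :
    IsAssociatedBundle (ofHom hφ hK β hβ) β (fun g k => (g.left, β g.right * k)) where
  contMDiff := contMDiff_fst.fst.prodMk ((hβ.comp contMDiff_fst.snd).mul contMDiff_snd)
  submersion x := by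
    have hq : ContMDiff ((𝓘(ℝ, EN).prod 𝓘(ℝ, EA)).prod 𝓘(ℝ, EK)) (𝓘(ℝ, EN).prod 𝓘(ℝ, EK)) ∞
        (fun x : (N × A) × K => (x.1.1, β x.1.2 * x.2)) :=
      contMDiff_fst.fst.prodMk ((hβ.comp contMDiff_fst.snd).mul contMDiff_snd)
    -- A section of the quotient map through the given `x`: its component in `A` is frozen at that
    -- of `x`.
    have hs : ContMDiff (𝓘(ℝ, EN).prod 𝓘(ℝ, EK)) ((𝓘(ℝ, EN).prod 𝓘(ℝ, EA)).prod 𝓘(ℝ, EK)) ∞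
        (fun y : N × K => ((y.1, x.1.2), (β x.1.2)⁻¹ * y.2)) :=
      (contMDiff_fst.prodMk contMDiff_const).prodMk (contMDiff_const.mul contMDiff_snd)
    exact mfderiv_surjective_of_rightInverse (hq.mdifferentiable (by simp) x)
      (hs.mdifferentiable (by simp) _) (by simp) fun y => by simp
  surjective z := ⟨⟨z.1, 1⟩, z.2, by simp⟩
  eq_iff g₁ k₁ g₂ k₂ := by
    constructor
    · intro h
      obtain ⟨h1, h2⟩ := Prod.ext_iff.1 h
      refine ⟨g₁.right⁻¹ * g₂.right, ?_, ?_⟩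
      · ext
        · simpa using h1.symm
        · simp
      · simp only at h2
        rw [map_mul, map_inv, mul_inv_rev, inv_inv, mul_assoc, h2, inv_mul_cancel_left]
    · rintro ⟨a, rfl, rfl⟩
      simp [mul_assoc]
  proj_eq _ _ := rfl
  rsmul_eq _ _ _ := by simp [mul_assoc]
  actK_eq g' g k := by rw [actK_ofHom]; simp [mul_assoc]

theorem EquivariantHermitianBundle.tangentMap_snd_actK_ofHom {β : A →* K}
    (hβ : ContMDiff 𝓘(ℝ, EA) 𝓘(ℝ, EK) ∞ β) (g : N ⋊[φ] A)
    (X : TangentBundle (𝓘(ℝ, EN).prod 𝓘(ℝ, EK)) (N × K)) :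
    tangentMap (𝓘(ℝ, EN).prod 𝓘(ℝ, EK)) 𝓘(ℝ, EK) Prod.snd
        (tangentMap (𝓘(ℝ, EN).prod 𝓘(ℝ, EK)) (𝓘(ℝ, EN).prod 𝓘(ℝ, EK))
          ((ofHom hφ hK β hβ).actK g) X) =
      tangentMap 𝓘(ℝ, EK) 𝓘(ℝ, EK) (fun k => β g.right * k)
        (tangentMap (𝓘(ℝ, EN).prod 𝓘(ℝ, EK)) 𝓘(ℝ, EK) Prod.snd X) := by
  have hd := ((ofHom hφ hK β hβ).contMDiff_actK_right g).mdifferentiable (by simp)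
  have h1 := congrFun (tangentMap_comp PrincipalBundle.mdifferentiable_snd hd) X
  have h2 := congrFun (tangentMap_comp (mdifferentiable_mul_left' (E := EK) (β g.right))
    (PrincipalBundle.mdifferentiable_snd (EB := EN) (B := N))) X
  have hc : Prod.snd ∘ ((ofHom hφ hK β hβ).actK g) = (fun k => β g.right * k) ∘ Prod.snd :=
    funext fun z => congrArg Prod.snd (actK_ofHom hφ hK hβ g z)
  rw [hc] at h1
  exact h1.symm.trans h2

theorem EquivariantHermitianBundle.tangentMap_fst_actK_ofHom {β : A →* K}
    (hβ : ContMDiff 𝓘(ℝ, EA) 𝓘(ℝ, EK) ∞ β) (g : N ⋊[φ] A)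
    (X : TangentBundle (𝓘(ℝ, EN).prod 𝓘(ℝ, EK)) (N × K)) :
    tangentMap (𝓘(ℝ, EN).prod 𝓘(ℝ, EK)) 𝓘(ℝ, EN) Prod.fst
        (tangentMap (𝓘(ℝ, EN).prod 𝓘(ℝ, EK)) (𝓘(ℝ, EN).prod 𝓘(ℝ, EK))
          ((ofHom hφ hK β hβ).actK g) X) =
      tangentMap 𝓘(ℝ, EN) 𝓘(ℝ, EN) (fun n => g.left * n)
        (tangentMap 𝓘(ℝ, EN) 𝓘(ℝ, EN) (φ g.right).toMonoidHom
          (tangentMap (𝓘(ℝ, EN).prod 𝓘(ℝ, EK)) 𝓘(ℝ, EN) Prod.fst X)) := by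
  have hφ' : MDifferentiable 𝓘(ℝ, EN) 𝓘(ℝ, EN) (φ g.right).toMonoidHom :=
    (hφ.comp ((contMDiff_const (c := g.right)).prodMk contMDiff_id)).mdifferentiable (by simp)
  have hd := ((ofHom hφ hK β hβ).contMDiff_actK_right g).mdifferentiable (by simp)
  have h1 := congrFun (tangentMap_comp PrincipalBundle.mdifferentiable_fst hd) X
  have h2 := congrFun (tangentMap_comp
    ((mdifferentiable_mul_left' (E := EN) g.left).comp hφ')
    (PrincipalBundle.mdifferentiable_fst (EG := EK) (G := K))) X
  rw [tangentMap_comp (mdifferentiable_mul_left' (E := EN) g.left) hφ'] at h2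
  have hc : Prod.fst ∘ ((ofHom hφ hK β hβ).actK g) =
      ((fun n => g.left * n) ∘ (φ g.right).toMonoidHom) ∘ Prod.fst :=
    funext fun z => congrArg Prod.fst (actK_ofHom hφ hK hβ g z)
  rw [hc] at h1
  exact h1.symm.trans h2

/-- The group acts on the factor `K` by left translations, under which the Maurer–Cartan form is
invariant. -/
theorem EquivariantHermitianBundle.isInvariant_trivialFlat {β : A →* K}
    (hβ : ContMDiff 𝓘(ℝ, EA) 𝓘(ℝ, EK) ∞ β) : EquivariantForm.IsInvariant
      (E := ofHom hφ hK β hβ) (PrincipalBundle.trivialFlat EN N EK K).toEquivariantForm := by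
  intro g z X
  refine (PrincipalBundle.trivialFlat_eval (tangentMap (𝓘(ℝ, EN).prod 𝓘(ℝ, EK))
    (𝓘(ℝ, EN).prod 𝓘(ℝ, EK)) ((ofHom hφ hK β hβ).actK g) ⟨z, X⟩)).trans ?_
  rw [tangentMap_snd_actK_ofHom, maurerCartanEval_mul_left]
  rfl

variable [FiniteDimensional ℝ EN]

/-- The linear map of an invariant pair, as a continuous linear map. -/
def InvariantPair.omegaCLM (p : InvariantPair EN EA φ EK K) :
    GroupLieAlgebra 𝓘(ℝ, EN) N →L[ℝ] GroupLieAlgebra 𝓘(ℝ, EK) K :=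
  (LinearMap.toContinuousLinearMap (E := EN) (F' := EK) p.omega : EN →L[ℝ] EK)

/-- An element `(u, a)` applies `φ(a)` to the Maurer–Cartan form of `N` and replaces `Ad(k⁻¹)` by
`Ad(k⁻¹) Ad(β(a)⁻¹)`. The two changes cancel precisely because `ω` is fixed by `a⁻¹`. -/
theorem EquivariantHermitianBundle.isInvariant_trivialAdjointForm
    (p : InvariantPair EN EA φ EK K) : EquivariantForm.IsInvariant
      (E := ofHom hφ hK p.β p.contMDiff_β)
      (PrincipalBundle.trivialAdjointForm p.omegaCLM).toEquivariantForm := by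
  intro g z X
  have hφ' : ContMDiff 𝓘(ℝ, EN) 𝓘(ℝ, EN) ∞ (φ g.right).toMonoidHom :=
    hφ.comp ((contMDiff_const (c := g.right)).prodMk contMDiff_id)
  have h := PrincipalBundle.trivialAdjointForm_eval p.omegaCLM
    (tangentMap (𝓘(ℝ, EN).prod 𝓘(ℝ, EK)) (𝓘(ℝ, EN).prod 𝓘(ℝ, EK))
      ((ofHom hφ hK p.β p.contMDiff_β).actK g) ⟨z, X⟩)
  refine h.trans (Eq.trans ?_
    (PrincipalBundle.trivialAdjointForm_eval p.omegaCLM ⟨z, X⟩).symm)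
  rw [tangentMap_fst_actK_ofHom, maurerCartanEval_mul_left, maurerCartanEval_map hφ']
  change lieAd EK ((ofHom hφ hK p.β p.contMDiff_β).actK g z).2⁻¹ (p.omega _) =
    lieAd EK z.2⁻¹ (p.omega _)
  rw [actK_ofHom, mul_inv_rev, lieAd_mul, ← map_inv]
  congr 1
  have h := p.invariant g.right⁻¹ (maurerCartanEval (tangentMap (𝓘(ℝ, EN).prod 𝓘(ℝ, EK)) 𝓘(ℝ, EN)
    Prod.fst ⟨z, X⟩))
  rw [inv_inv] at h
  exact h

/-- The quadruple constructed from an invariant pair. -/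
@[reducible] def HermitianQuadruple.ofPair (p : InvariantPair EN EA φ EK K) :
    HermitianQuadruple EN EA EH φ K EK where
  toEquivariantHermitianBundle := .ofHom hφ hK p.β p.contMDiff_β
  conn := (PrincipalBundle.trivialFlat EN N EK K).add
    (PrincipalBundle.trivialAdjointForm p.omegaCLM)
  invariant g z X := congrArg₂ (· - ·)
    (EquivariantHermitianBundle.isInvariant_trivialFlat hφ hK p.contMDiff_β g z X)
    (EquivariantHermitianBundle.isInvariant_trivialAdjointForm hφ hK p g z X)

theorem HermitianQuadruple.isConstructedFrom_ofPair [LieGroup 𝓘(ℝ, EA) ∞ A]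
    (p : InvariantPair EN EA φ EK K) : (ofPair (EH := EH) hφ hK p).IsConstructedFrom p := by
  refine ⟨_, EquivariantHermitianBundle.isAssociatedBundle_ofHom hφ hK p.contMDiff_β,
    PrincipalBundle.trivialFlat EN N EK K, PrincipalBundle.trivialAdjointForm p.omegaCLM, ?_,
    EquivariantHermitianBundle.isInvariant_trivialAdjointForm hφ hK p, ?_,
    PrincipalConnection.isSum_add _ _⟩
  · intro g k v
    have hφ' : ContMDiff 𝓘(ℝ, EN) 𝓘(ℝ, EN) ∞ (φ g.right) :=
      hφ.comp ((contMDiff_const (c := g.right)).prodMk contMDiff_id)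
    -- Along the leaf `g N` the component in `K` is constant, so the flat form vanishes on its
    -- tangent vectors.
    let f : N → N × K := fun n =>
      ((g * SemidirectProduct.inl n).left, p.β (g * SemidirectProduct.inl n).right * k)
    have hfe : f = fun n => (g.left * φ g.right n, p.β g.right * k) := by
      funext n; simp [f]
    have hf : ContMDiff 𝓘(ℝ, EN) (𝓘(ℝ, EN).prod 𝓘(ℝ, EK)) ∞ f := by
      rw [hfe]
      exact (contMDiff_const.mul hφ').prodMk contMDiff_const
    have hc : Prod.snd ∘ f = fun _ => p.β g.right * k := by rw [hfe]; rfl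
    have h := congrFun (tangentMap_comp PrincipalBundle.mdifferentiable_snd
      (hf.mdifferentiable (by simp))) ⟨1, v⟩
    rw [hc] at h
    exact (congrArg maurerCartanEval h.symm).trans
      (maurerCartanEval_tangentMap_const (p.β g.right * k) _)
  · intro X
    -- At `(1, 1)` both the adjoint factor and the Maurer–Cartan form of `N` are the identity,
    -- leaving `ω`.
    have hz : (((1 : N ⋊[φ] A).left, p.β (1 : N ⋊[φ] A).right * 1) : N × K) = (1, 1) := by simp
    refine (PrincipalBundle.trivialAdjointForm_eval p.omegaCLM ⟨_, X⟩).trans ?_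
    have h1 : ((1 : N ⋊[φ] A).left, p.β (1 : N ⋊[φ] A).right * 1).2⁻¹ = (1 : K) := by simp
    change lieAd EK ((1 : N ⋊[φ] A).left, p.β (1 : N ⋊[φ] A).right * 1).2⁻¹ (p.omega _) = _
    rw [h1, lieAd_one]
    congr 1
    exact maurerCartanEval_one _

end Model

/-! ### Trivialization by a global section -/

section Section

variable {EB : Type*} [NormedAddCommGroup EB] [NormedSpace ℝ EB]
  {B : Type u} [TopologicalSpace B] [ChartedSpace EB B]
  {EG : Type*} [NormedAddCommGroup EG] [NormedSpace ℝ EG]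
  {G : Type u} [TopologicalSpace G] [ChartedSpace EG G] [Group G] [LieGroup 𝓘(ℝ, EG) ∞ G]

/-- The trivialization of a principal bundle given by a smooth global section. -/
def PrincipalBundle.diffeomorphOfSection (P : PrincipalBundle EB B EG G) {s : B → P.carrier}
    (hs : ContMDiff 𝓘(ℝ, EB) P.model ∞ s) (hp : ∀ b, P.proj (s b) = b) :
    Diffeomorph (𝓘(ℝ, EB).prod 𝓘(ℝ, EG)) P.model (B × G) P.carrier ∞ where
  toFun x := P.rsmul (s x.1) x.2
  invFun w := (P.proj w, (P.exists_rsmul_eq (hp (P.proj w)).symm).choose)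
  left_inv x := by
    have hx : P.proj (P.rsmul (s x.1) x.2) = x.1 := by rw [P.proj_rsmul, hp]
    refine Prod.ext hx (P.rsmul_injective (s x.1) ?_)
    have h := (P.exists_rsmul_eq (hp (P.proj (P.rsmul (s x.1) x.2))).symm).choose_spec
    exact (congrArg (fun b => P.rsmul (s b) _) hx.symm).trans h.symm
  right_inv w := (P.exists_rsmul_eq (hp (P.proj w)).symm).choose_spec.symm
  contMDiff_toFun := P.contMDiff_rsmul.comp ((hs.comp contMDiff_fst).prodMk contMDiff_snd)
  contMDiff_invFun := P.contMDiff_proj.prodMk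
    (P.contMDiff_of_eq_rsmul (s := fun w => s (P.proj w)) (f := id) (hs.comp P.contMDiff_proj)
      contMDiff_id fun w => (P.exists_rsmul_eq (hp (P.proj w)).symm).choose_spec)

end Section

/-! ### Every quadruple is isomorphic to a model -/

section Classification

variable {EN : Type*} [NormedAddCommGroup EN] [NormedSpace ℝ EN]
  {N : Type u} [TopologicalSpace N] [ChartedSpace EN N] [Group N] [LieGroup 𝓘(ℝ, EN) ∞ N]
  {EA : Type*} [NormedAddCommGroup EA] [NormedSpace ℝ EA]
  {A : Type*} [TopologicalSpace A] [ChartedSpace EA A] [Group A]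
  {EH : Type*} [NormedAddCommGroup EH] [NormedSpace ℝ EH]
  {H : Type u} [TopologicalSpace H] [ChartedSpace EH H] [Group H]
  {φ : A →* MulAut N}
  {K : Subgroup H} {EK : Type*} [NormedAddCommGroup EK] [NormedSpace ℝ EK] [ChartedSpace EK K]

/-- Writing `n z = m (m⁻¹ n) z` with `m` the base point of `X`, invariance of the connection under
`m` reduces the computation to `z`. -/
theorem HermitianQuadruple.eval_tangentMap_actK_inl (Q : HermitianQuadruple EN EA EH φ K EK)
    (z : Q.bundleK.carrier) (X : TangentBundle 𝓘(ℝ, EN) N) :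
    Q.conn.eval (tangentMap 𝓘(ℝ, EN) Q.bundleK.model
        (fun n : N => Q.actK (SemidirectProduct.inl n) z) X) =
      Q.conn.form z (Q.delta z (maurerCartanEval X)) := by
  have hd := (Q.contMDiff_actK_inl z).mdifferentiable (n := ∞) (by simp)
  have hn := (Q.contMDiff_actK_right (SemidirectProduct.inl X.proj)).mdifferentiable
    (n := ∞) (by simp)
  have hm := mdifferentiable_mul_left' (E := EN) X.proj⁻¹
  have hc : (fun n : N => Q.actK (SemidirectProduct.inl n) z) =
      Q.actK (SemidirectProduct.inl X.proj) ∘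
        (fun n : N => Q.actK (SemidirectProduct.inl n) z) ∘ fun n => X.proj⁻¹ * n := by
    funext n
    simp only [Function.comp_apply]
    rw [← Q.actK_mul, ← map_mul, mul_inv_cancel_left]
  have h : tangentMap 𝓘(ℝ, EN) Q.bundleK.model
      (fun n : N => Q.actK (SemidirectProduct.inl n) z) X =
      tangentMap Q.bundleK.model Q.bundleK.model (Q.actK (SemidirectProduct.inl X.proj))
        ⟨z, Q.delta z (maurerCartanEval X)⟩ := by
    rw [Q.mk_delta, mk_maurerCartanEval]
    conv_lhs => rw [hc]
    rw [tangentMap_comp hn (hd.comp hm), tangentMap_comp hd hm]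
    rfl
  rw [h, EquivariantForm.IsInvariant.eval_actK Q.invariant]
  rfl

variable [LieGroup 𝓘(ℝ, EH) ∞ H] [LieGroup 𝓘(ℝ, EK) ∞ K] [FiniteDimensional ℝ EN]

/-- A quadruple off which the pair `p` is read is isomorphic to the one constructed from `p`. -/
theorem HermitianQuadruple.ReadsOff.isIsomorphic_ofPair
    (hφ : ContMDiff (𝓘(ℝ, EA).prod 𝓘(ℝ, EN)) 𝓘(ℝ, EN) ∞ (fun p : A × N => φ p.1 p.2))
    (hK : Manifold.IsSmoothEmbedding 𝓘(ℝ, EK) 𝓘(ℝ, EH) ∞ (Subtype.val : K → H))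
    {Q : HermitianQuadruple EN EA EH φ K EK} {z : Q.bundleK.carrier}
    {hz : Q.bundleK.proj z = 1} {p : InvariantPair EN EA φ EK K} (h : Q.ReadsOff z hz p) :
    (ofPair hφ hK p).IsIsomorphic Q := by
  rw [readsOff_iff] at h
  obtain ⟨hβ, hω⟩ := h
  have hsK := Q.contMDiff_actK_inl z
  have hsH : ContMDiff 𝓘(ℝ, EN) Q.bundleH.model ∞
      (fun n : N => Q.incl (Q.actK (SemidirectProduct.inl n) z)) :=
    Q.isSmoothEmbedding_incl.contMDiff.comp hsK
  have hpK := Q.proj_actK_inl hz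
  have hpH (n : N) : Q.bundleH.proj (Q.incl (Q.actK (SemidirectProduct.inl n) z)) = n := by
    rw [Q.proj_incl, hpK]
  refine ⟨{ toH := Q.bundleH.diffeomorphOfSection hsH hpH
            toK := Q.bundleK.diffeomorphOfSection hsK hpK
            incl_toK := fun x => Q.incl_rsmul _ _
            proj_toH := fun x => (Q.bundleH.proj_rsmul _ _).trans (hpH _)
            toH_rsmul := fun x k => Q.bundleH.rsmul_mul _ _ _
            toH_act := fun g x => ?_
            conn_toK := ?_ }⟩
  · change Q.bundleH.rsmul (Q.incl (Q.actK (SemidirectProduct.inl (g.left * φ g.right x.1)) z))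
        (p.β g.right * x.2) =
      Q.act g (Q.bundleH.rsmul (Q.incl (Q.actK (SemidirectProduct.inl x.1) z)) x.2)
    -- Moving the component in `A` to the right lets it act on `z`, where it becomes right
    -- multiplication by `β`.
    have hg : g * SemidirectProduct.inl x.1 =
        SemidirectProduct.inl (g.left * φ g.right x.1) * SemidirectProduct.inr g.right := by
      ext <;> simp
    rw [Q.act_rsmul, ← Q.incl_actK, ← Q.actK_mul, hg, Q.actK_mul, hβ, Q.actK_rsmul, Q.incl_rsmul,
      Q.bundleH.rsmul_mul]
  · intro x X
    have hF : MDifferentiableAt (𝓘(ℝ, EN).prod 𝓘(ℝ, EK)) Q.bundleK.model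
        (fun x : N × K => Q.bundleK.rsmul (Q.actK (SemidirectProduct.inl x.1) z) x.2) x :=
      (Q.bundleK.diffeomorphOfSection hsK hpK).contMDiff.mdifferentiable (by simp) x
    -- The connection form pulled back along `(n, k) ↦ n z k` is computed separately on the
    -- directions of `N` and of `K`. They give `-Ad(k⁻¹) ω` of the Maurer–Cartan form of `N`, and
    -- the Maurer–Cartan form of `K`; the sum is the form of the model.
    have hN : Q.conn.eval (tangentMap 𝓘(ℝ, EN) Q.bundleK.model
        (fun n : N => Q.bundleK.rsmul (Q.actK (SemidirectProduct.inl n) z) x.2) ⟨x.1, X.1⟩) =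
        -lieAd EK x.2⁻¹ (p.omega (maurerCartanEval ⟨x.1, X.1⟩)) := by
      have h1 := congrFun (tangentMap_comp
        ((Q.bundleK.contMDiff_rsmul_right x.2).mdifferentiable (by simp))
        (hsK.mdifferentiable (by simp))) ⟨x.1, X.1⟩
      refine (congrArg Q.conn.eval h1).trans ?_
      rw [Function.comp_apply, Q.conn.eval_rsmul, Q.eval_tangentMap_actK_inl, hω, map_neg, neg_neg]
    have hKK := Q.conn.eval_orbit (Q.actK (SemidirectProduct.inl x.1) z) x.2 X.2
    have hsum := congrArg (Q.conn.form (Q.bundleK.rsmul (Q.actK (SemidirectProduct.inl x.1) z) x.2))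
      (mfderiv_prod_eq_add_apply (v := X) hF)
    refine hsum.trans ((map_add _ _ _).trans ((congrArg₂ (· + ·) hN hKK).trans ?_))
    change _ = maurerCartanEval (tangentMap (𝓘(ℝ, EN).prod 𝓘(ℝ, EK)) 𝓘(ℝ, EK) Prod.snd ⟨x, X⟩) -
      lieAd EK x.2⁻¹ (p.omega (maurerCartanEval
        (tangentMap (𝓘(ℝ, EN).prod 𝓘(ℝ, EK)) 𝓘(ℝ, EN) Prod.fst ⟨x, X⟩)))
    rw [tangentMap_prodFst, tangentMap_prodSnd]
    exact (neg_add_eq_sub _ _)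

end Classification

/-! ### The bijection on classes -/

section Bijection

variable {EN : Type*} [NormedAddCommGroup EN] [NormedSpace ℝ EN] [FiniteDimensional ℝ EN]
  {N : Type u} [TopologicalSpace N] [ChartedSpace EN N] [Group N] [LieGroup 𝓘(ℝ, EN) ∞ N]
  {EA : Type*} [NormedAddCommGroup EA] [NormedSpace ℝ EA]
  {A : Type*} [TopologicalSpace A] [ChartedSpace EA A] [Group A] [LieGroup 𝓘(ℝ, EA) ∞ A]
  {EH : Type*} [NormedAddCommGroup EH] [NormedSpace ℝ EH]
  {H : Type u} [TopologicalSpace H] [ChartedSpace EH H] [Group H] [LieGroup 𝓘(ℝ, EH) ∞ H]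
  {φ : A →* MulAut N}
  {K : Subgroup H} {EK : Type*} [NormedAddCommGroup EK] [NormedSpace ℝ EK] [ChartedSpace EK K]
  [LieGroup 𝓘(ℝ, EK) ∞ K]

/-- The pair `p'` is itself read off the model of `p`, at a translated point, so that quadruple is
also isomorphic to the model of `p'`. -/
theorem HermitianQuadruple.isIsomorphic_of_isEquivalent
    (hφ : ContMDiff (𝓘(ℝ, EA).prod 𝓘(ℝ, EN)) 𝓘(ℝ, EN) ∞ (fun p : A × N => φ p.1 p.2))
    (hK : Manifold.IsSmoothEmbedding 𝓘(ℝ, EK) 𝓘(ℝ, EH) ∞ (Subtype.val : K → H))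
    {p p' : InvariantPair EN EA φ EK K} (h : p.IsEquivalent p') :
    (ofPair (EH := EH) hφ hK p).IsIsomorphic (ofPair hφ hK p') := by
  obtain ⟨k, hβ, hω⟩ := h
  obtain ⟨z, hz, hr⟩ := (isConstructedFrom_ofPair (EH := EH) hφ hK p).exists_readsOff
  exact ((hr.rsmul k hβ hω).isIsomorphic_ofPair hφ hK).symm

/-- The bijection between equivalence classes of invariant pairs and isomorphism classes of
quadruples, for a smooth action of a real Lie group. -/
theorem HermitianQuadruple.exists_equiv_classes
    (hφ : ContMDiff (𝓘(ℝ, EA).prod 𝓘(ℝ, EN)) 𝓘(ℝ, EN) ∞ (fun p : A × N => φ p.1 p.2))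
    (hK : Manifold.IsSmoothEmbedding 𝓘(ℝ, EK) 𝓘(ℝ, EH) ∞ (Subtype.val : K → H)) :
    ∃ Φ : InvariantPairClasses EN EA φ EK K ≃ HermitianQuadrupleClasses EN EA EH φ K EK,
      (∀ p : InvariantPair EN EA φ EK K,
        (∃ Q : HermitianQuadruple EN EA EH φ K EK, Q.IsConstructedFrom p) ∧
        ∀ Q : HermitianQuadruple EN EA EH φ K EK, Q.IsConstructedFrom p → Φ p.cls = Q.cls) ∧
      (∀ Q : HermitianQuadruple EN EA EH φ K EK,
        (∃ z, Q.bundleK.proj z = 1) ∧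
        ∀ (z : Q.bundleK.carrier) (hz : Q.bundleK.proj z = 1),
          (∃! p : InvariantPair EN EA φ EK K, Q.ReadsOff z hz p) ∧
          ∀ p : InvariantPair EN EA φ EK K, Q.ReadsOff z hz p → Φ.symm Q.cls = p.cls) := by
  have hφ' (a : A) : ContMDiff 𝓘(ℝ, EN) 𝓘(ℝ, EN) ∞ (φ a) :=
    hφ.comp ((contMDiff_const (c := a)).prodMk contMDiff_id)
  let F : InvariantPairClasses EN EA φ EK K → HermitianQuadrupleClasses EN EA EH φ K EK :=
    Quotient.lift (fun p => (ofPair hφ hK p).cls)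
      fun p p' h => Quotient.sound (isIsomorphic_of_isEquivalent hφ hK h)
  -- Surjectivity and both descriptions of the bijection follow from this one compatibility, since a
  -- quadruple constructed from `p` also has `p` read off it.
  have hF {Q : HermitianQuadruple EN EA EH φ K EK} {z : Q.bundleK.carrier}
      {hz : Q.bundleK.proj z = 1} {p : InvariantPair EN EA φ EK K} (h : Q.ReadsOff z hz p) :
      F p.cls = Q.cls := Quotient.sound (h.isIsomorphic_ofPair hφ hK)
  have hbij : Function.Bijective F := by
    constructor
    · rintro ⟨p⟩ ⟨p'⟩ h
      obtain ⟨z, hz, hr⟩ := (isConstructedFrom_ofPair (EH := EH) hφ hK p).exists_readsOff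
      obtain ⟨z', hz', hr'⟩ := (isConstructedFrom_ofPair (EH := EH) hφ hK p').exists_readsOff
      exact Quotient.sound (isEquivalent_of_isIsomorphic (Quotient.exact h) hr hr')
    · rintro ⟨Q⟩
      obtain ⟨z, hz⟩ := Q.bundleK.nonempty_fibre 1
      obtain ⟨p, hp⟩ := exists_readsOff hφ' z hz
      exact ⟨p.cls, hF hp⟩
  refine ⟨Equiv.ofBijective F hbij,
    fun p => ⟨⟨_, isConstructedFrom_ofPair hφ hK p⟩, fun Q hQ => ?_⟩,
    fun Q => ⟨Q.bundleK.nonempty_fibre 1, fun z hz => ⟨existsUnique_readsOff hφ' z hz,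
      fun p hp => (Equiv.symm_apply_eq _).2 (hF hp).symm⟩⟩⟩
  obtain ⟨z, hz, hr⟩ := hQ.exists_readsOff
  exact hF hr

end Bijection

end

/-! ### The proposition for complex Lie groups -/

theorem proposition4p2
    -- the connected complex Lie group `N`
    {EN : Type*} [NormedAddCommGroup EN] [NormedSpace ℂ EN] [FiniteDimensional ℂ EN]
    {N : Type u} [TopologicalSpace N] [ChartedSpace EN N] [Group N] [LieGroup 𝓘(ℂ, EN) ω N]
    [ConnectedSpace N]
    -- the connected reductive complex linear algebraic group `S`
    {ES : Type*} [NormedAddCommGroup ES] [NormedSpace ℂ ES] [FiniteDimensional ℂ ES]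
    {S : Type*} [TopologicalSpace S] [ChartedSpace ES S] [Group S] [LieGroup 𝓘(ℂ, ES) ω S]
    [ConnectedSpace S] (hS : IsReductiveLinearAlgebraic ES S)
    -- the holomorphic action of `S` on `N` by automorphisms
    (η : S →* MulAut N)
    (hη : ContMDiff (𝓘(ℂ, ES).prod 𝓘(ℂ, EN)) 𝓘(ℂ, EN) ω (fun p : S × N => η p.1 p.2))
    -- the maximal compact subgroup `K(S)` of `S`, with its structure of an embedded Lie subgroup
    (KS : Subgroup S) (hKS : IsMaximalCompactSubgroup KS)
    {EKS : Type*} [NormedAddCommGroup EKS] [NormedSpace ℝ EKS] [FiniteDimensional ℝ EKS]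
    [ChartedSpace EKS KS] [LieGroup 𝓘(ℝ, EKS) ∞ KS]
    (hKS' : Manifold.IsSmoothEmbedding 𝓘(ℝ, EKS) 𝓘(ℝ, ES) ∞ (Subtype.val : KS → S))
    -- the connected reductive complex linear algebraic group `H`
    {EH : Type*} [NormedAddCommGroup EH] [NormedSpace ℂ EH] [FiniteDimensional ℂ EH]
    {H : Type u} [TopologicalSpace H] [ChartedSpace EH H] [Group H] [LieGroup 𝓘(ℂ, EH) ω H]
    [ConnectedSpace H] (hH : IsReductiveLinearAlgebraic EH H)
    -- the maximal compact subgroup `K` of `H`, with its structure of an embedded Lie subgroup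
    (K : Subgroup H) (hK : IsMaximalCompactSubgroup K)
    {EK : Type*} [NormedAddCommGroup EK] [NormedSpace ℝ EK] [FiniteDimensional ℝ EK]
    [ChartedSpace EK K] [LieGroup 𝓘(ℝ, EK) ∞ K]
    (hK' : Manifold.IsSmoothEmbedding 𝓘(ℝ, EK) 𝓘(ℝ, EH) ∞ (Subtype.val : K → H)) :
    ∃ Φ : InvariantPairClasses EN EKS (η.comp KS.subtype) EK K ≃
        HermitianQuadrupleClasses EN EKS EH (η.comp KS.subtype) K EK,
      -- the map from pairs to bundles with connection
      (∀ p : InvariantPair EN EKS (η.comp KS.subtype) EK K,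
        (∃ Q : HermitianQuadruple EN EKS EH (η.comp KS.subtype) K EK, Q.IsConstructedFrom p) ∧
        ∀ Q : HermitianQuadruple EN EKS EH (η.comp KS.subtype) K EK,
          Q.IsConstructedFrom p → Φ p.cls = Q.cls) ∧
      -- the inverse map, computed at any point over the identity element of `N`
      (∀ Q : HermitianQuadruple EN EKS EH (η.comp KS.subtype) K EK,
        (∃ z, Q.bundleK.proj z = 1) ∧
        ∀ (z : Q.bundleK.carrier) (hz : Q.bundleK.proj z = 1),
          (∃! p : InvariantPair EN EKS (η.comp KS.subtype) EK K, Q.ReadsOff z hz p) ∧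
          ∀ p : InvariantPair EN EKS (η.comp KS.subtype) EK K, Q.ReadsOff z hz p →
            Φ.symm Q.cls = p.cls) := by
  have hN : LieGroup 𝓘(ℝ, EN) ∞ N := .restrictScalars_real
  have hH' : LieGroup 𝓘(ℝ, EH) ∞ H := .restrictScalars_real
  have hEN : FiniteDimensional ℝ EN := FiniteDimensional.complexToReal EN
  -- The holomorphic action of `S` is smooth over `ℝ`, and it is restricted along the smooth
  -- inclusion of `K(S)`.
  have hφ : ContMDiff (𝓘(ℝ, EKS).prod 𝓘(ℝ, EN)) 𝓘(ℝ, EN) ∞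
      (fun p : KS × N => (η.comp KS.subtype) p.1 p.2) :=
    hη.restrictScalars_real_prod.comp
      ((hKS'.contMDiff.comp contMDiff_fst).prodMk contMDiff_snd)
  exact HermitianQuadruple.exists_equiv_classes hφ hK'
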